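/- Let $(\Omega,\mathcal F,\mathbb F=\{\mathcal F_t\}_{t\in[0,1]},\mathbb P)$ be a filtered probability space, and let $X=\{X(t),t\in[0,1]\}$ be an $\mathbb F$-adapted real process. Let $\alpha>1/2$ and assume: (1) (Hölder continuity) for every $r\in(0,\alpha)$, almost surely there is a finite (possibly random) constant $C$ with $|X(t)-X(s)|\le C|t-s|^{r}$ for all $s,t\in[0,1]$ (in particular this holds if almost every path of $X$ is Hölder continuous of order $\alpha$); (2) (small balls near $t=1$) there are constants $\delta>0$ and $C>0$ such that for all $s\le t$ in $[1-\delta,1]\cap[0,1]$, with $\Delta=t-s$, and all $0<\varepsilon\le\Delta^{\alpha}$, $$\mathbb P\Big(\sup_{s\le u\le t}|X(u)-X(s)|\le\varepsilon\Big)\le\exp\big(-C\Delta\,\varepsilon^{-1/\alpha}\big).$$ Let $\xi$ be a random variable such that $\xi=z(1)$ a.s. for some $\mathbb F$-adapted process $\{z(t),t\in[0,1]\}$ almost all of whose paths are Hölder continuous of some fixed order $a>0$ (with a possibly random constant). Then there exist an $\mathbb F$-adapted process $\{\psi(t),t\in[0,1]\}$, almost surely continuous on $[0,1)$, and a number $\beta\in(0,1)$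 with $\beta>1-\alpha$, such that almost surely the generalized Lebesgue--Stieltjes integral of $\psi$ with respect to $X$ over the whole interval $[0,1]$ exists (with the order $\beta$) and $$\int_0^1\psi(s)\,\mathrm dX(s)=\xi .$$ Here, for $f,g:[0,1]\to\mathbb R$ with $f$ measurable and $g_{1-}(x)=g(x)-g(1)$, put $$D_{0+}^{\beta}f(x)=\tfrac1{\Gamma(1-\beta)}\Big(\tfrac{f(x)}{x^{\beta}}+\beta\int_0^x\tfrac{f(x)-f(u)}{(x-u)^{\beta+1}}\,\mathrm du\Big),$$ $$D_{1-}^{1-\beta}g(x)=\tfrac{e^{i\pi(1-\beta)}}{\Gamma(\beta)}\Big(\tfrac{g(x)}{(1-x)^{1-\beta}}+(1-\beta)\int_x^1\tfrac{g(x)-g(u)}{(u-x)^{2-\beta}}\,\mathrm du\Big).$$ The integral exists (with the order $\beta$) if $$\int_0^1\Big(\tfrac{|f(t)|}{t^{\beta}}+\int_0^t\tfrac{|f(t)-f(s)|}{(t-s)^{\beta+1}}\,\mathrm ds\Big)\mathrm dt<\infty,$$ the inner integrals in $D_{0+}^{\beta}f(x)$ and $D_{1-}^{1-\beta}g_{1-}(x)$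 converge absolutely for almost every $x\in[0,1]$, $D_{0+}^{\beta}f\in L_1[0,1]$ and $D_{1-}^{1-\beta}g_{1-}\in L_\infty[0,1]$; its value is $$\int_0^1 f\,\mathrm dg=e^{i\pi\beta}\int_0^1 D_{0+}^{\beta}f(x)\,D_{1-}^{1-\beta}g_{1-}(x)\,\mathrm dx .$$ -/

import Mathlib

open MeasureTheory Set unitInterval
open scoped ENNReal

noncomputable section

namespace GLS

/-- The left-sided fractional (Weyl–Marchaud) derivative `D_{a+}^β f` at `x`. -/
def leftDeriv (β a : ℝ) (f : ℝ → ℝ) (x : ℝ) : ℝ :=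
  1 / Real.Gamma (1 - β) *
    (f x / (x - a) ^ β + β * ∫ u in a..x, (f x - f u) / (x - u) ^ (β + 1))

/-- The right-sided fractional (Weyl–Marchaud) derivative `D_{b-}^{1-β} g` at `x`. The phase is
`(-1)^{1-β} = e^{iπ(1-β)}`, so that `∫_a^b 1 dg = g b - g a` for the integral below. -/
def rightDeriv (β b : ℝ) (g : ℝ → ℝ) (x : ℝ) : ℂ :=
  Complex.exp (Complex.I * Real.pi * (1 - β)) / (Real.Gamma β : ℂ) *
    ((g x / (b - x) ^ (1 - β)
      + (1 - β) * ∫ u in x..b, (g x - g u) / (u - x) ^ (2 - β) : ℝ) : ℂ)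

/-- The norm `‖f‖_{β;[a,b]}`, with values in `[0, ∞]`. -/
def fracNorm (β a b : ℝ) (f : ℝ → ℝ) : ℝ≥0∞ :=
  ∫⁻ t in Icc a b, (ENNReal.ofReal (|f t| / (t - a) ^ β)
    + ∫⁻ s in Icc a t, ENNReal.ofReal (|f t - f s| / (t - s) ^ (β + 1)))

/-- `HasIntegral β a b f g J`: the generalized Lebesgue–Stieltjes integral `∫_a^b f dg`, computed
with fractional derivatives of orders `β` and `1 - β`, exists as a proper integral over `[a, b]`
and equals `J`. -/
structure HasIntegral (β a b : ℝ) (f g : ℝ → ℝ) (J : ℝ) : Prop where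
  /-- `f` is measurable on `[a, b]`. -/
  aemeasurable : AEMeasurable f (volume.restrict (Icc a b))
  /-- `f` is an admissible integrand: `‖f‖_{β;[a,b]} < ∞`. -/
  norm_lt_top : fracNorm β a b f < ∞
  /-- The integral inside `D_{a+}^β f` converges at almost every point. -/
  left_integrable : ∀ᵐ x ∂(volume.restrict (Icc a b)),
    IntervalIntegrable (fun u => (f x - f u) / (x - u) ^ (β + 1)) volume a x
  /-- `D_{a+}^β f ∈ L_1[a, b]`. -/
  left_memLp : MemLp (leftDeriv β a f) 1 (volume.restrict (Icc a b))
  /-- The integral inside `D_{b-}^{1-β} g_{b-}` converges at almost every point. -/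
  right_integrable : ∀ᵐ x ∂(volume.restrict (Icc a b)),
    IntervalIntegrable (fun u => (g x - g u) / (u - x) ^ (2 - β)) volume x b
  /-- `D_{b-}^{1-β} g_{b-} ∈ L_∞[a, b]`, where `g_{b-}(x) = g(x) - g(b)`. -/
  right_memLp : MemLp (rightDeriv β b fun x => g x - g b) ∞ (volume.restrict (Icc a b))
  /-- The value of the integral. -/
  value : Complex.exp (Complex.I * Real.pi * β) *
      ∫ x in a..b, (leftDeriv β a f x : ℂ) * rightDeriv β b (fun x => g x - g b) x = (J : ℂ)

/-- Almost every path of `Y` is Hölder continuous of order `r` on `[0, 1]`, with a constant that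
may depend on the path. -/
def HolderPaths {Ω : Type*} [MeasurableSpace Ω] (P : Measure Ω) (Y : I → Ω → ℝ) (r : ℝ) : Prop :=
  ∀ᵐ ω ∂P, ∃ C : ℝ, ∀ s t : I, |Y t ω - Y s ω| ≤ C * |(t : ℝ) - s| ^ r

/-- The small ball estimate near the end point `1`; the event is
`sup_{s ≤ u ≤ t} |X(u) - X(s)| ≤ ε`. -/
def SmallBall {Ω : Type*} [MeasurableSpace Ω] (P : Measure Ω) (X : I → Ω → ℝ) (α : ℝ) : Prop :=
  ∃ δ : ℝ, 0 < δ ∧ ∃ C : ℝ, 0 < C ∧ ∀ s t : I, 1 - δ ≤ (s : ℝ) → s ≤ t →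
    ∀ ε : ℝ, 0 < ε → ε ≤ ((t : ℝ) - s) ^ α →
      P.real {ω | ∀ u ∈ Icc s t, |X u ω - X s ω| ≤ ε}
        ≤ Real.exp (-C * ((t : ℝ) - s) * ε ^ (-1 / α))

end GLS

end

/-!
The integrand is assembled from blocks on the intervals `[t_n, t_{n+1}]` with `t_n = 1 - 2^{-(n+1)}`
and `Δ_n = t_{n+1} - t_n`. Let `φ` be smooth with `φ 0 = 0` and `φ y = 1` for `|y| ≥ ε_n = Δ_n^ρ`,
where `ρ` is slightly larger than `α`. The `n`-th block is a multiple of `φ'(X - X(t_n))` until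
`|X - X(t_n)|` reaches `ε_n`, and vanishes afterwards. By the change of variables formula its
integral is the same multiple of `1` when the level is reached before `t_{n+1}`. Small balls and the
Borel–Cantelli lemma show that almost surely all but finitely many blocks succeed. Taking as factor
the gap between `z(t_n)` and the integral accumulated so far, a successful block makes the integral
equal to `z(t_n)`, and these values converge to `z(1)`.

If `X` is Hölder continuous of order `r < α` and all gaps are `O(Δ_n^κ)`, the norm of the `n`-th
block is `O(Δ_n^{κ + 1 + r - β - 2ρ})`. As `α > 1/2`, one can take `r` and `ρ` close to `α` and `β`
close to `1 - α` so that this is summable, whence the series of blocks can be integrated termwise.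

The change of variables formula holds trivially for smooth integrators, and passes to Hölder
continuous ones by averaging over short intervals.
-/

noncomputable section

namespace GLS

open Filter Topology TopologicalSpace
open scoped NNReal

lemma abs_sub_le_of_holderWith {C r : ℝ≥0} {f : ℝ → ℝ} (hf : HolderWith C r f) (s t : ℝ) :
    |f t - f s| ≤ C * |t - s| ^ (r : ℝ) := by
  simpa only [Real.dist_eq] using hf.dist_le t s

lemma holderWith_of_dist_le {E F : Type*} [PseudoMetricSpace E] [PseudoMetricSpace F] {C r : ℝ≥0}
    {f : E → F} (h : ∀ s t, dist (f s) (f t) ≤ C * dist s t ^ (r : ℝ)) : HolderWith C r f := by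
  intro s t
  have hC : ENNReal.ofReal C = C := ENNReal.ofReal_coe_nnreal
  rw [edist_dist, edist_dist, ENNReal.ofReal_rpow_of_nonneg dist_nonneg r.coe_nonneg, ← hC,
    ← ENNReal.ofReal_mul C.coe_nonneg]
  exact ENNReal.ofReal_le_ofReal (h s t)

/-- The Weyl–Marchaud derivative of order `β` with base point `0`, without the factor
`1 / Γ(1 - β)` of `leftDeriv`. -/
def marchaud (β : ℝ) (f : ℝ → ℝ) (x : ℝ) : ℝ :=
  f x / x ^ β + β * ∫ u in (0 : ℝ)..x, (f x - f u) / (x - u) ^ (β + 1)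

/-- The reflection `y ↦ g_{1-}(1 - y)`, which turns right-sided derivatives at `1` into left-sided
derivatives at `0`. -/
def reflect (g : ℝ → ℝ) (y : ℝ) : ℝ := g (1 - y) - g 1

lemma reflect_zero (g : ℝ → ℝ) : reflect g 0 = 0 := by simp [reflect]

lemma holderWith_reflect {C r : ℝ≥0} {g : ℝ → ℝ} (hg : HolderWith C r g) :
    HolderWith C r (reflect g) := fun s t => by
  simpa only [reflect, edist_sub_right, edist_sub_left] using hg (1 - s) (1 - t)

section Kernel

variable {C r : ℝ≥0} {β : ℝ} {f : ℝ → ℝ}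

lemma intervalIntegrable_sub_rpow {s : ℝ} (hs : -1 < s) (a b : ℝ) :
    IntervalIntegrable (fun u : ℝ => (b - u) ^ s) volume a b := by
  simpa using (intervalIntegral.intervalIntegrable_rpow' (a := b - a) (b := 0) hs).comp_sub_left b

lemma integral_sub_rpow {s : ℝ} (hs : -1 < s) (a b : ℝ) :
    ∫ u in a..b, (b - u) ^ s = (b - a) ^ (s + 1) / (s + 1) := by
  rw [intervalIntegral.integral_comp_sub_left (fun u => u ^ s) b, integral_rpow (Or.inl hs)]
  simp [Real.zero_rpow (by linarith : s + 1 ≠ 0)]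

lemma abs_increment_div_rpow_le (hf : HolderWith C r f) {x u : ℝ} (hu : u ≤ x) :
    |(f x - f u) / (x - u) ^ (β + 1)| ≤ C * (x - u) ^ (r - β - 1) := by
  rcases hu.eq_or_lt with rfl | hu
  · simpa using mul_nonneg C.coe_nonneg (Real.rpow_nonneg le_rfl _)
  have hxu : 0 < x - u := sub_pos.2 hu
  rw [abs_div, abs_of_pos (Real.rpow_pos_of_pos hxu _), div_le_iff₀ (Real.rpow_pos_of_pos hxu _),
    mul_assoc, ← Real.rpow_add hxu, show r - β - 1 + (β + 1) = r by ring]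
  simpa only [abs_of_pos hxu] using abs_sub_le_of_holderWith hf u x

lemma measurable_increment_div_rpow (hf : Measurable f) (β x : ℝ) :
    Measurable fun u => (f x - f u) / (x - u) ^ (β + 1) := by fun_prop

lemma intervalIntegrable_increment_div_rpow (hf : HolderWith C r f) (hr : 0 < r) (hβ : β < r)
    {a x : ℝ} (hx : a ≤ x) :
    IntervalIntegrable (fun u => (f x - f u) / (x - u) ^ (β + 1)) volume a x := by
  refine ((intervalIntegrable_sub_rpow (s := r - β - 1) (by linarith) a x).const_mul C).mono_fun'
    (measurable_increment_div_rpow (hf.continuous hr).measurable β x).aestronglyMeasurable ?_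
  rw [uIoc_of_le hx]
  filter_upwards [ae_restrict_mem measurableSet_Ioc] with u hu
  exact abs_increment_div_rpow_le hf hu.2

lemma abs_marchaud_le (hf : HolderWith C r f) (hβ0 : 0 < β) (hβ : β < r) (h0 : f 0 = 0) {x : ℝ}
    (hx : x ∈ Ioc 0 1) : |marchaud β f x| ≤ C * (1 + β / (r - β)) := by
  have hxb := Real.rpow_pos_of_pos hx.1 β
  have hr : 0 < r - β := sub_pos.2 hβ
  have boundary : |f x / x ^ β| ≤ C * x ^ (r - β) := by
    rw [abs_div, abs_of_pos hxb, div_le_iff₀ hxb, mul_assoc, ← Real.rpow_add hx.1, sub_add_cancel]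
    simpa [h0, abs_of_pos hx.1] using abs_sub_le_of_holderWith hf 0 x
  have integral : |∫ u in (0 : ℝ)..x, (f x - f u) / (x - u) ^ (β + 1)|
      ≤ C * (x ^ (r - β) / (r - β)) := by
    have := intervalIntegral.norm_integral_le_of_norm_le (μ := volume) hx.1.le
      (f := fun u => (f x - f u) / (x - u) ^ (β + 1))
      (Eventually.of_forall fun u hu => abs_increment_div_rpow_le (β := β) hf hu.2)
      ((intervalIntegrable_sub_rpow (s := r - β - 1) (by linarith) 0 x).const_mul C)
    rwa [intervalIntegral.integral_const_mul, integral_sub_rpow (by linarith),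
      sub_add_cancel, sub_zero] at this
  calc |marchaud β f x|
      ≤ |f x / x ^ β| + |β * ∫ u in (0 : ℝ)..x, (f x - f u) / (x - u) ^ (β + 1)| := abs_add_le _ _
    _ ≤ C * x ^ (r - β) + β * (C * (x ^ (r - β) / (r - β))) := by
      rw [abs_mul, abs_of_pos hβ0]; gcongr
    _ = C * (1 + β / (r - β)) * x ^ (r - β) := by ring
    _ ≤ C * (1 + β / (r - β)) :=
      mul_le_of_le_one_right (by positivity) (Real.rpow_le_one hx.1.le hx.2 hr.le)

lemma tendsto_marchaud {F : ℕ → ℝ → ℝ} (hF : ∀ n, HolderWith C r (F n)) (hr : 0 < r) (hβ : β < r)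
    (hlim : ∀ x, Tendsto (fun n => F n x) atTop (𝓝 (f x))) {x : ℝ} (hx : 0 ≤ x) :
    Tendsto (fun n => marchaud β (F n) x) atTop (𝓝 (marchaud β f x)) := by
  refine ((hlim x).div_const _).add (Tendsto.const_mul _ ?_)
  refine intervalIntegral.tendsto_integral_filter_of_dominated_convergence
    (fun u => C * (x - u) ^ (r - β - 1)) (Eventually.of_forall fun n =>
      (measurable_increment_div_rpow ((hF n).continuous hr).measurable β x).aestronglyMeasurable)
    (Eventually.of_forall fun n => Eventually.of_forall fun u hu => ?_)
    ((intervalIntegrable_sub_rpow (by linarith) 0 x).const_mul C)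
    (Eventually.of_forall fun u _ => ((hlim x).sub (hlim u)).div_const _)
  rw [uIoc_of_le hx] at hu
  exact abs_increment_div_rpow_le (hF n) hu.2

lemma measurable_indicator_marchaud (hf : Measurable f) (β : ℝ) :
    Measurable ((Ioi (0 : ℝ)).indicator (marchaud β f)) := by
  have h : (Ioi (0 : ℝ)).indicator (marchaud β f) = (Ioi (0 : ℝ)).indicator fun x =>
      f x / x ^ β + β * ∫ u, {z : ℝ × ℝ | 0 < z.2 ∧ z.2 ≤ z.1}.indicator
        (fun z => (f z.1 - f z.2) / (z.1 - z.2) ^ (β + 1)) (x, u) := by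
    refine indicator_congr fun x hx => ?_
    rw [marchaud, intervalIntegral.integral_of_le (le_of_lt hx),
      ← integral_indicator measurableSet_Ioc]
    rfl
  rw [h]
  refine Measurable.indicator (Measurable.add (by fun_prop) (Measurable.const_mul ?_ _))
    measurableSet_Ioi
  refine (StronglyMeasurable.integral_prod_right' (ν := volume) ?_).measurable
  refine (Measurable.indicator (by fun_prop) ?_).stronglyMeasurable
  exact (measurableSet_lt measurable_const measurable_snd).inter
    (measurableSet_le measurable_snd measurable_fst)

lemma aestronglyMeasurable_marchaud (hf : Measurable f) (β : ℝ) :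
    AEStronglyMeasurable (marchaud β f) (volume.restrict (Ioi 0)) := by
  refine (measurable_indicator_marchaud hf β).aestronglyMeasurable.congr ?_
  filter_upwards [ae_restrict_mem measurableSet_Ioi] with x hx
  rw [indicator_of_mem hx]

lemma aestronglyMeasurable_marchaud_one_sub (hf : Measurable f) (β : ℝ) :
    AEStronglyMeasurable (fun x => marchaud β f (1 - x)) (volume.restrict (Iio 1)) := by
  have h : Measurable fun x => (Ioi (0 : ℝ)).indicator (marchaud β f) (1 - x) :=
    (measurable_indicator_marchaud hf β).comp (by fun_prop)
  refine h.aestronglyMeasurable.congr ?_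
  filter_upwards [ae_restrict_mem measurableSet_Iio] with x hx
  rw [indicator_of_mem (mem_Ioi.2 (sub_pos.2 hx))]

end Kernel

section FractionalCalculus

lemma integral_rpow_mul_rpow_eq_beta {s t a b : ℝ} (hs : 0 < s) (ht : 0 < t) (hab : a < b) :
    ∫ x in a..b, (x - a) ^ (s - 1) * (b - x) ^ (t - 1)
      = (b - a) ^ (s + t - 1) * ProbabilityTheory.beta s t := by
  have hL : 0 < b - a := sub_pos.2 hab
  have scaled := congrArg Complex.re (Complex.betaIntegral_scaled s t hL)
  have translate := intervalIntegral.integral_comp_sub_right (a := a) (b := b)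
    (fun x => x ^ (s - 1) * (b - a - x) ^ (t - 1)) a
  simp only [sub_self, sub_sub_sub_cancel_right] at translate
  rw [translate, ProbabilityTheory.beta_eq_betaIntegralReal s t hs ht]
  have hpow : ((b - a : ℝ) : ℂ) ^ ((s : ℂ) + t - 1) = (((b - a) ^ (s + t - 1) : ℝ) : ℂ) := by
    rw [Complex.ofReal_cpow hL.le]
    push_cast
    rfl
  rw [hpow, Complex.re_ofReal_mul] at scaled
  rw [← scaled, ← Complex.ofReal_re (∫ x in 0..b - a, x ^ (s - 1) * (b - a - x) ^ (t - 1)),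
    ← intervalIntegral.integral_ofReal]
  congr 1
  refine intervalIntegral.integral_congr fun x hx => ?_
  rw [uIcc_of_le hL.le] at hx
  simp only [Complex.ofReal_mul, Complex.ofReal_cpow hx.1,
    Complex.ofReal_cpow (sub_nonneg.2 hx.2), Complex.ofReal_sub, Complex.ofReal_one]

variable {a b s M : ℝ} {f g : ℝ → ℝ}

lemma integrable_triangle_mul_rpow (hs : -1 < s)
    (hf : AEStronglyMeasurable f (volume.restrict (Ioc a b)))
    (hM : ∀ᵐ x ∂volume.restrict (Ioc a b), ‖f x‖ ≤ M) (hg : IntegrableOn g (Ioc a b)) :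
    Integrable (Function.uncurry fun y x => (Iio y).indicator (fun x => f x * (y - x) ^ s * g y) x)
      ((volume.restrict (Ioc a b)).prod (volume.restrict (Ioc a b))) := by
  set k : ℝ → ℝ := (Ioo 0 (b - a)).indicator fun y => y ^ s
  have hk : Integrable k := by
    rcases lt_or_ge a b with hab | hab
    · rw [integrable_indicator_iff measurableSet_Ioo]
      exact (intervalIntegral.integrableOn_Ioo_rpow_iff (sub_pos.2 hab)).2 hs
    · simp [k, Ioo_eq_empty (not_lt.2 (sub_nonpos.2 hab))]
  have hgk : Integrable (fun z : ℝ × ℝ => (Ioc a b).indicator g z.1 * k (z.1 - z.2))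
      (volume.prod volume) := by
    have := ((hg.integrable_indicator measurableSet_Ioc).convolution_integrand
      (ContinuousLinearMap.mul ℝ ℝ) hk.comp_neg).swap
    simpa [Function.comp_def] using this
  have hbdd : Integrable (fun z : ℝ × ℝ => f z.2 * ((Ioc a b).indicator g z.1 * k (z.1 - z.2)))
      ((volume.restrict (Ioc a b)).prod (volume.restrict (Ioc a b))) :=
    (hgk.mono_measure (Measure.prod_mono Measure.restrict_le_self Measure.restrict_le_self)).bdd_mul
      hf.comp_snd (Measure.quasiMeasurePreserving_snd.ae hM)
  refine hbdd.congr ?_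
  rw [Measure.prod_restrict]
  filter_upwards [ae_restrict_mem (measurableSet_Ioc.prod measurableSet_Ioc)] with ⟨y, x⟩ ⟨hy, hx⟩
  dsimp only [Function.uncurry_apply_pair] at hx hy ⊢
  by_cases hxy : x < y
  · have : y - x ∈ Ioo 0 (b - a) := ⟨sub_pos.2 hxy, by linarith [hy.2, hx.1]⟩
    rw [indicator_of_mem hy, indicator_of_mem (mem_Iio.2 hxy), show k (y - x) = (y - x) ^ s from
      indicator_of_mem this _]
    ring
  · have : y - x ∉ Ioo 0 (b - a) := fun h => hxy (sub_pos.1 h.1)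
    rw [indicator_of_notMem (show x ∉ Iio y from hxy), show k (y - x) = 0 from
      indicator_of_notMem this _, mul_zero, mul_zero]

lemma integral_integral_mul_sub_rpow (hab : a ≤ b) (hs : -1 < s)
    (hf : AEStronglyMeasurable f (volume.restrict (Ioc a b)))
    (hM : ∀ᵐ x ∂volume.restrict (Ioc a b), ‖f x‖ ≤ M) (hg : IntegrableOn g (Ioc a b)) :
    ∫ y in a..b, (∫ x in a..y, f x * (y - x) ^ s) * g y
      = ∫ x in a..b, f x * ∫ y in x..b, g y * (y - x) ^ s := by
  have swap := integral_integral_swap (integrable_triangle_mul_rpow hs hf hM hg)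
  rw [intervalIntegral.integral_of_le hab, intervalIntegral.integral_of_le hab]
  convert swap using 1 <;> refine setIntegral_congr_fun measurableSet_Ioc fun v hv => ?_
  · have hset : Ioc a b ∩ Iio v = Ioo a v := by
      ext x
      exact ⟨fun h => ⟨h.1.1, h.2⟩, fun h => ⟨⟨h.1, h.2.le.trans hv.2⟩, h.2⟩⟩
    simp only [setIntegral_indicator measurableSet_Iio, hset, integral_mul_const,
      intervalIntegral.integral_of_le hv.1.le, integral_Ioc_eq_integral_Ioo]
  · have hset : Ioc a b ∩ Ioi v = Ioc v b := by rw [Ioc_inter_Ioi, max_eq_right hv.1.le]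
    have hflip (y : ℝ) : (Iio y).indicator (fun x => f x * (y - x) ^ s * g y) v
        = (Ioi v).indicator (fun y => f v * (g y * (y - v) ^ s)) y := by
      simp only [indicator_apply, mem_Iio, mem_Ioi, mul_assoc, mul_comm (g y)]
    simp only [hflip, setIntegral_indicator measurableSet_Ioi, hset, integral_const_mul,
      intervalIntegral.integral_of_le hv.2]

lemma tendsto_increment_mul_sub_rpow {C r : ℝ≥0} (hf : HolderWith C r f) (hs : 0 < s + r) (x : ℝ) :
    Tendsto (fun y => (f x - f y) * (x - y) ^ s) (𝓝[<] x) (𝓝 0) := by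
  have hlim : Tendsto (fun y : ℝ => C * (x - y) ^ (s + r)) (𝓝[<] x) (𝓝 0) := by
    have : Continuous fun y : ℝ => C * (x - y) ^ (s + r) :=
      continuous_const.mul ((continuous_const.sub continuous_id).rpow_const fun _ => Or.inr hs.le)
    simpa [Real.zero_rpow hs.ne'] using (this.tendsto x).mono_left nhdsWithin_le_nhds
  refine squeeze_zero_norm' ?_ hlim
  filter_upwards [self_mem_nhdsWithin] with y hy
  have := abs_increment_div_rpow_le (β := -s - 1) hf (le_of_lt hy)
  rwa [sub_add_cancel, Real.rpow_neg (sub_nonneg.2 (le_of_lt hy)), div_inv_eq_mul,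
    show (r : ℝ) - (-s - 1) - 1 = s + r by ring] at this

end FractionalCalculus

section Lipschitz

variable {C : ℝ≥0} {β : ℝ} {f : ℝ → ℝ}

lemma integral_increment_div_rpow_eq (hf : LipschitzWith C f) {x y : ℝ} (hy : 0 ≤ y)
    (hyx : y < x) :
    β * ∫ u in (0 : ℝ)..y, (f x - f u) / (x - u) ^ (β + 1)
      = (f x - f y) * (x - y) ^ (-β) - (f x - f 0) * x ^ (-β)
        + ∫ u in (0 : ℝ)..y, deriv f u * (x - u) ^ (-β) := by
  have hpow (u : ℝ) (hu : u ∈ uIcc 0 y) :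
      HasDerivAt (fun u : ℝ => (x - u) ^ (-β)) (β * (x - u) ^ (-(β + 1))) u := by
    rw [uIcc_of_le hy] at hu
    refine (((hasDerivAt_id u).const_sub x).rpow_const
      (Or.inl (sub_pos.2 (hu.2.trans_lt hyx)).ne')).congr_deriv ?_
    rw [neg_add', id]
    ring
  have hAC : AbsolutelyContinuousOnInterval (fun u : ℝ => (x - u) ^ (-β)) 0 y := by
    have hsmooth : ContDiffOn ℝ 1 (fun u : ℝ => (x - u) ^ (-β)) (uIcc 0 y) := fun u hu =>
      ((contDiff_const.sub contDiff_id).contDiffAt.rpow_const_of_ne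
        (sub_pos.2 (((uIcc_of_le hy ▸ hu).2).trans_lt hyx)).ne').contDiffWithinAt
    obtain ⟨K, hK⟩ := hsmooth.exists_lipschitzOnWith one_ne_zero (convex_uIcc 0 y) isCompact_uIcc
    exact hK.absolutelyContinuousOnInterval
  have hAC' : AbsolutelyContinuousOnInterval (fun u => f x - f u) 0 y :=
    ((LipschitzWith.const (f x)).sub hf).lipschitzOnWith.absolutelyContinuousOnInterval
  have parts := hAC'.integral_mul_deriv_eq_deriv_mul hAC
  simp only [deriv_const_sub, neg_mul, intervalIntegral.integral_neg, sub_zero,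
    sub_neg_eq_add] at parts
  rw [← parts, ← intervalIntegral.integral_const_mul]
  refine intervalIntegral.integral_congr fun u hu => ?_
  have : 0 ≤ x - u := by
    rw [uIcc_of_le hy] at hu
    exact sub_nonneg.2 (hu.2.trans hyx.le)
  simp only [(hpow u hu).deriv, Real.rpow_neg this (β + 1)]
  ring

lemma intervalIntegrable_deriv_mul_sub_rpow (hf : LipschitzWith C f) (hβ : β < 1) (a x : ℝ) :
    IntervalIntegrable (fun v => deriv f v * (x - v) ^ (-β)) volume a x :=
  intervalIntegrable_iff.2 <|
    (intervalIntegrable_iff.1 (intervalIntegrable_sub_rpow (by linarith) a x)).bdd_mul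
      (measurable_deriv f).aestronglyMeasurable
      (Eventually.of_forall fun _ => norm_deriv_le_of_lipschitz hf)

lemma marchaud_eq_integral_deriv (hf : LipschitzWith C f) (h0 : f 0 = 0) (hβ : β < 1) {x : ℝ}
    (hx : 0 < x) :
    marchaud β f x = ∫ v in (0 : ℝ)..x, deriv f v * (x - v) ^ (-β) := by
  have hint : IntervalIntegrable (fun u => (f x - f u) / (x - u) ^ (β + 1)) volume 0 x :=
    intervalIntegrable_increment_div_rpow (holderWith_one.2 hf) one_pos hβ hx.le
  have hleft : 𝓝[<] x ≤ 𝓝[uIcc 0 x] x := by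
    rw [← nhdsWithin_Ioo_eq_nhdsLT hx, uIcc_of_le hx.le]
    exact nhdsWithin_mono x Ioo_subset_Icc_self
  have lim_left := ((intervalIntegral.continuousOn_primitive_interval' hint left_mem_uIcc x
    right_mem_uIcc).mono_left hleft).const_mul β
  have lim_right := (intervalIntegral.continuousOn_primitive_interval'
    (intervalIntegrable_deriv_mul_sub_rpow hf hβ 0 x) left_mem_uIcc x right_mem_uIcc).mono_left
    hleft
  have identity := tendsto_nhds_unique_of_eventuallyEq lim_left
    (((tendsto_increment_mul_sub_rpow (holderWith_one.2 hf) (s := -β) (by simpa using hβ)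
      x).sub_const ((f x - f 0) * x ^ (-β))).add lim_right) <| by
      filter_upwards [Ioo_mem_nhdsLT hx] with y hy
      exact integral_increment_div_rpow_eq hf hy.1.le hy.2
  rw [marchaud, identity, h0, Real.rpow_neg hx.le]
  ring

end Lipschitz

lemma beta_one_sub (β : ℝ) :
    ProbabilityTheory.beta (1 - β) β = Real.Gamma β * Real.Gamma (1 - β) := by
  rw [ProbabilityTheory.beta, sub_add_cancel, Real.Gamma_one, div_one, mul_comm]

/-- Riemann–Liouville integration inverts the Marchaud derivative; the Gamma factors appear on the
right because both operators are written without them. -/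
lemma integral_marchaud_mul_sub_rpow {C : ℝ≥0} {β : ℝ} {f : ℝ → ℝ} (hf : LipschitzWith C f)
    (h0 : f 0 = 0) (hβ0 : 0 < β) (hβ1 : β < 1) {w : ℝ} (hw : 0 ≤ w) :
    ∫ x in (0 : ℝ)..w, marchaud β f x * (w - x) ^ (β - 1)
      = Real.Gamma β * Real.Gamma (1 - β) * f w := by
  have hβ : -1 < β - 1 := by linarith
  calc ∫ x in (0 : ℝ)..w, marchaud β f x * (w - x) ^ (β - 1)
      = ∫ x in (0 : ℝ)..w, (∫ v in (0 : ℝ)..x, deriv f v * (x - v) ^ (-β)) * (w - x) ^ (β - 1) :=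
        intervalIntegral.integral_congr_Ioo_of_le hw fun x hx => by
          simp only [marchaud_eq_integral_deriv hf h0 hβ1 hx.1]
    _ = ∫ v in (0 : ℝ)..w, deriv f v * ∫ x in v..w, (w - x) ^ (β - 1) * (x - v) ^ (-β) :=
        integral_integral_mul_sub_rpow hw (by linarith) (measurable_deriv f).aestronglyMeasurable
          (Eventually.of_forall fun _ => norm_deriv_le_of_lipschitz hf)
          ((intervalIntegrable_iff_integrableOn_Ioc_of_le hw).1
            (intervalIntegrable_sub_rpow hβ 0 w))
    _ = ∫ v in (0 : ℝ)..w, deriv f v * (Real.Gamma β * Real.Gamma (1 - β)) :=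
        intervalIntegral.integral_congr_Ioo_of_le hw fun v hv => by
          have := integral_rpow_mul_rpow_eq_beta (sub_pos.2 hβ1) hβ0 hv.2
          rw [sub_sub_cancel_left, sub_add_cancel, sub_self, Real.rpow_zero, one_mul,
            beta_one_sub] at this
          simp only [mul_comm ((w - _) ^ (β - 1)), this]
    _ = Real.Gamma β * Real.Gamma (1 - β) * f w := by
        rw [intervalIntegral.integral_mul_const,
          hf.lipschitzOnWith.absolutelyContinuousOnInterval.integral_deriv_eq_sub, h0, sub_zero,
          mul_comm]

lemma marchaud_reflect_eq_integral_deriv {C : ℝ≥0} {β : ℝ} {g : ℝ → ℝ} (hg : LipschitzWith C g)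
    (hβ : 0 < β) {x : ℝ} (hx : x < 1) :
    marchaud (1 - β) (reflect g) (1 - x) = -∫ w in x..1, deriv g w * (w - x) ^ (β - 1) := by
  have hderiv : deriv (reflect g) = fun y => -deriv g (1 - y) := by
    ext y
    unfold reflect
    rw [deriv_sub_const, deriv_comp_const_sub]
  rw [marchaud_eq_integral_deriv (holderWith_one.1 (holderWith_reflect (holderWith_one.2 hg)))
    (reflect_zero g) (by linarith) (sub_pos.2 hx), hderiv, ← intervalIntegral.integral_neg]
  have := intervalIntegral.integral_comp_sub_left (a := (0 : ℝ)) (b := 1 - x)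
    (fun w => -(deriv g w * (w - x) ^ (β - 1))) 1
  simpa only [sub_sub_cancel, sub_zero, neg_mul, neg_sub, sub_right_comm] using this

/-- The value of the generalized Lebesgue–Stieltjes integral `∫_0^1 f dg` computed with derivatives
of orders `β` and `1 - β`. The phases in `HasIntegral` multiply to `e^{iπ} = -1`, so the value is
real. -/
def glsIntegral (β : ℝ) (f g : ℝ → ℝ) : ℝ :=
  -(Real.Gamma β * Real.Gamma (1 - β))⁻¹ *
    ∫ x in (0 : ℝ)..1, marchaud β f x * marchaud (1 - β) (reflect g) (1 - x)

lemma glsIntegral_eq_integral_mul_deriv {C C' : ℝ≥0} {β : ℝ} {f g : ℝ → ℝ}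
    (hβ0 : 0 < β) (hβ1 : β < 1) (hf : LipschitzWith C f) (h0 : f 0 = 0)
    (hg : LipschitzWith C' g) :
    glsIntegral β f g = ∫ x in (0 : ℝ)..1, f x * deriv g x := by
  have hΓ : Real.Gamma β * Real.Gamma (1 - β) ≠ 0 :=
    (mul_pos (Real.Gamma_pos_of_pos hβ0) (Real.Gamma_pos_of_pos (sub_pos.2 hβ1))).ne'
  have hmeas : AEStronglyMeasurable (marchaud β f) (volume.restrict (Ioc 0 1)) :=
    (aestronglyMeasurable_marchaud hf.continuous.measurable β).mono_set Ioc_subset_Ioi_self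
  have hbound : ∀ᵐ x ∂volume.restrict (Ioc (0 : ℝ) 1),
      ‖marchaud β f x‖ ≤ C * (1 + β / ((1 : ℝ≥0) - β)) := by
    filter_upwards [ae_restrict_mem measurableSet_Ioc] with x hx
    exact abs_marchaud_le (holderWith_one.2 hf) hβ0 hβ1 h0 hx
  have hderiv : IntegrableOn (deriv g) (Ioc 0 1) :=
    (intervalIntegrable_iff_integrableOn_Ioc_of_le zero_le_one).1
      hg.lipschitzOnWith.absolutelyContinuousOnInterval.intervalIntegrable_deriv
  have key : ∫ x in (0 : ℝ)..1, marchaud β f x * marchaud (1 - β) (reflect g) (1 - x)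
      = -(Real.Gamma β * Real.Gamma (1 - β) * ∫ x in (0 : ℝ)..1, f x * deriv g x) :=
    calc ∫ x in (0 : ℝ)..1, marchaud β f x * marchaud (1 - β) (reflect g) (1 - x)
        = ∫ x in (0 : ℝ)..1, -(marchaud β f x * ∫ w in x..1, deriv g w * (w - x) ^ (β - 1)) :=
          intervalIntegral.integral_congr_Ioo_of_le zero_le_one fun x hx => by
            simp only [marchaud_reflect_eq_integral_deriv hg hβ0 hx.2, mul_neg]
      _ = -∫ w in (0 : ℝ)..1, (∫ x in (0 : ℝ)..w, marchaud β f x * (w - x) ^ (β - 1))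
            * deriv g w := by
          rw [intervalIntegral.integral_neg,
            integral_integral_mul_sub_rpow zero_le_one (by linarith) hmeas hbound hderiv]
      _ = -(Real.Gamma β * Real.Gamma (1 - β) * ∫ x in (0 : ℝ)..1, f x * deriv g x) := by
          rw [← intervalIntegral.integral_const_mul]
          congr 1
          refine intervalIntegral.integral_congr_Ioo_of_le zero_le_one fun w hw => ?_
          simp only [integral_marchaud_mul_sub_rpow hf h0 hβ0 hβ1 hw.1.le, mul_assoc]
  rw [glsIntegral, key, neg_mul_neg, inv_mul_cancel_left₀ hΓ]

lemma abs_marchaud_reflect_le {C r : ℝ≥0} {β : ℝ} {g : ℝ → ℝ} (hg : HolderWith C r g)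
    (hβ1 : β < 1) (hβr : 1 - β < r) {x : ℝ} (hx : x ∈ Ioo 0 1) :
    |marchaud (1 - β) (reflect g) (1 - x)| ≤ C * (1 + (1 - β) / (r - (1 - β))) :=
  abs_marchaud_le (holderWith_reflect hg) (sub_pos.2 hβ1) hβr (reflect_zero g)
    ⟨sub_pos.2 hx.2, sub_le_self _ hx.1.le⟩

lemma aestronglyMeasurable_marchaud_reflect {g : ℝ → ℝ} (hg : Continuous g) (β : ℝ) :
    AEStronglyMeasurable (fun x => marchaud (1 - β) (reflect g) (1 - x))
      (volume.restrict (Ioo 0 1)) := by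
  have hreflect : Measurable (reflect g) := by unfold reflect; fun_prop
  exact (aestronglyMeasurable_marchaud_one_sub hreflect (1 - β)).mono_set Ioo_subset_Iio_self

lemma tendsto_glsIntegral {C C' r r' : ℝ≥0} {β : ℝ} {F G : ℕ → ℝ → ℝ} {f g : ℝ → ℝ}
    (hβ0 : 0 < β) (hβ1 : β < 1) (hβr : β < r) (hβr' : 1 - β < r')
    (hF : ∀ n, HolderWith C r (F n)) (hF0 : ∀ n, F n 0 = 0) (hG : ∀ n, HolderWith C' r' (G n))
    (hFlim : ∀ x, Tendsto (fun n => F n x) atTop (𝓝 (f x)))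
    (hGlim : ∀ x, Tendsto (fun n => G n x) atTop (𝓝 (g x))) :
    Tendsto (fun n => glsIntegral β (F n) (G n)) atTop (𝓝 (glsIntegral β f g)) := by
  have hr : 0 < r := NNReal.coe_pos.1 (hβ0.trans hβr)
  have hr' : 0 < r' := NNReal.coe_pos.1 ((sub_pos.2 hβ1).trans hβr')
  refine Tendsto.const_mul _ ?_
  simp only [intervalIntegral.integral_of_le zero_le_one, integral_Ioc_eq_integral_Ioo]
  refine tendsto_integral_of_dominated_convergence
    (fun _ => C * (1 + β / (r - β)) * (C' * (1 + (1 - β) / (r' - (1 - β)))))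
    (fun n => ?_) (integrable_const _) (fun n => ?_) ?_
  · exact ((aestronglyMeasurable_marchaud ((hF n).continuous hr).measurable β).mono_set
      Ioo_subset_Ioi_self).mul (aestronglyMeasurable_marchaud_reflect ((hG n).continuous hr') β)
  · filter_upwards [ae_restrict_mem measurableSet_Ioo] with x hx
    have left := abs_marchaud_le (hF n) hβ0 hβr (hF0 n) ⟨hx.1, hx.2.le⟩
    rw [Real.norm_eq_abs, abs_mul]
    exact mul_le_mul left (abs_marchaud_reflect_le (hG n) hβ1 hβr' hx) (abs_nonneg _)
      ((abs_nonneg _).trans left)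
  · filter_upwards [ae_restrict_mem measurableSet_Ioo] with x hx
    exact (tendsto_marchaud hF hr hβr hFlim hx.1.le).mul
      (tendsto_marchaud (fun n => holderWith_reflect (hG n)) hr' hβr'
        (fun y => (hGlim _).sub (hGlim _)) (sub_nonneg.2 hx.2.le))

/-- The Steklov mean of `g` over `[x, x + η]`, a smoothing that preserves Hölder constants. -/
def steklov (η : ℝ) (g : ℝ → ℝ) (x : ℝ) : ℝ := ∫ u in (0 : ℝ)..1, g (x + η * u)

section Steklov

variable {C r : ℝ≥0} {η : ℝ} {g : ℝ → ℝ}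

lemma holderWith_steklov (hg : HolderWith C r g) (hr : 0 < r) (η : ℝ) :
    HolderWith C r (steklov η g) := by
  have hc := hg.continuous hr
  refine holderWith_of_dist_le fun s t => ?_
  rw [Real.dist_eq, Real.dist_eq, steklov, steklov, ← intervalIntegral.integral_sub
    (Continuous.intervalIntegrable (by fun_prop) _ _)
    (Continuous.intervalIntegrable (by fun_prop) _ _)]
  simpa using intervalIntegral.norm_integral_le_of_norm_le_const (a := (0 : ℝ)) (b := 1)
    (f := fun u => g (s + η * u) - g (t + η * u)) (C := C * |s - t| ^ (r : ℝ)) fun u _ => by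
      simpa using abs_sub_le_of_holderWith hg (t + η * u) (s + η * u)

lemma hasDerivAt_steklov (hg : Continuous g) (hη : η ≠ 0) (x : ℝ) :
    HasDerivAt (steklov η g) (η⁻¹ * (g (x + η) - g x)) x := by
  have eq_primitive : steklov η g
      = fun x => η⁻¹ * ((∫ u in (0 : ℝ)..(x + η), g u) - ∫ u in (0 : ℝ)..x, g u) := by
    ext y
    rw [steklov, intervalIntegral.integral_comp_add_mul g hη y,
      intervalIntegral.integral_interval_sub_left (hg.intervalIntegrable _ _)
        (hg.intervalIntegrable _ _)]
    simp
  rw [eq_primitive]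
  exact (((hg.integral_hasStrictDerivAt 0 (x + η)).hasDerivAt.comp_add_const x η).sub
    (hg.integral_hasStrictDerivAt 0 x).hasDerivAt).const_mul _

lemma contDiff_steklov (hg : Continuous g) (hη : η ≠ 0) : ContDiff ℝ 1 (steklov η g) := by
  refine contDiff_one_iff_deriv.2
    ⟨fun x => (hasDerivAt_steklov hg hη x).differentiableAt, ?_⟩
  rw [funext fun x => (hasDerivAt_steklov hg hη x).deriv]
  fun_prop

lemma lipschitzWith_steklov (hg : HolderWith C r g) (hr : 0 < r) (hη : η ≠ 0) :
    LipschitzWith (‖η‖₊⁻¹ * (C * ‖η‖₊ ^ (r : ℝ))) (steklov η g) := by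
  refine lipschitzWith_of_nnnorm_deriv_le
    ((contDiff_steklov (hg.continuous hr) hη).differentiable one_ne_zero) fun x => ?_
  rw [(hasDerivAt_steklov (hg.continuous hr) hη x).deriv, nnnorm_mul, nnnorm_inv]
  gcongr
  rw [← NNReal.coe_le_coe]
  simpa using abs_sub_le_of_holderWith hg x (x + η)

lemma tendsto_steklov (hg : Continuous g) (x : ℝ) :
    Tendsto (fun n : ℕ => steklov (1 / ((n : ℝ) + 1)) g x) atTop (𝓝 (g x)) := by
  have hcont : Continuous fun η => steklov η g x := by
    unfold steklov
    exact intervalIntegral.continuous_parametric_intervalIntegral_of_continuous' (by fun_prop) _ _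
  simpa [steklov, Function.comp_def] using
    (hcont.tendsto 0).comp tendsto_one_div_add_atTop_nhds_zero_nat

end Steklov

/-- The integrand `h (g - g c)`, started at time `c` and kept constant from time `d` on. -/
def frozen (h g : ℝ → ℝ) (c d s : ℝ) : ℝ := h (g (max c (min d s)) - g c)

section Frozen

variable {C r Λ : ℝ≥0} {β c d s : ℝ} {h K g : ℝ → ℝ}

lemma holderWith_frozen (hg : HolderWith C r g) (hh : LipschitzWith Λ h) (c d : ℝ) :
    HolderWith (Λ * C) r (frozen h g c d) := by
  have clamp : LipschitzWith 1 fun s => max c (min d s) :=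
    (LipschitzWith.id.const_min d).const_max c
  have increment : HolderWith C r fun x => g x - g c := fun x y => by
    simpa only [edist_sub_right] using hg x y
  have composite := (holderWith_one.2 hh).comp (increment.comp (holderWith_one.2 clamp))
  simp only [mul_one, one_mul, NNReal.one_rpow, NNReal.coe_one, NNReal.rpow_one] at composite
  exact composite

lemma frozen_of_le (h0 : h 0 = 0) (hs : s ≤ c) : frozen h g c d s = 0 := by
  rw [frozen, max_eq_left ((min_le_right d s).trans hs), sub_self, h0]

lemma frozen_of_mem (hs : s ∈ Icc c d) : frozen h g c d s = h (g s - g c) := by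
  rw [frozen, min_eq_right hs.2, max_eq_right hs.1]

lemma frozen_of_ge (hcd : c ≤ d) (hs : d ≤ s) : frozen h g c d s = h (g d - g c) := by
  rw [frozen, min_eq_left hs, max_eq_right hcd]

lemma integral_frozen_mul_deriv (hc : 0 ≤ c) (hcd : c ≤ d) (hd : d ≤ 1)
    (hK : ∀ x, HasDerivAt K (h x) x) (hh : Continuous h) (h0 : h 0 = 0) (hK0 : K 0 = 0)
    (hg : ContDiff ℝ 1 g) :
    ∫ s in (0 : ℝ)..1, frozen h g c d s * deriv g s
      = K (g d - g c) + h (g d - g c) * (g 1 - g d) := by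
  have hgd : ∀ x, HasDerivAt g (deriv g x) x := fun x =>
    (hg.differentiable one_ne_zero x).hasDerivAt
  have hg' : Continuous (deriv g) := hg.continuous_deriv le_rfl
  have hgc : Continuous g := hg.continuous
  have integrable : ∀ a b, IntervalIntegrable (fun s => frozen h g c d s * deriv g s) volume a b :=
    fun a b => Continuous.intervalIntegrable (by unfold frozen; fun_prop) a b
  have before : ∫ s in (0 : ℝ)..c, frozen h g c d s * deriv g s = 0 := by
    rw [intervalIntegral.integral_congr_Ioo_of_le (g := fun _ => 0) hc fun s hs => by
      simp only [frozen_of_le h0 hs.2.le, zero_mul], intervalIntegral.integral_zero]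
  have during : ∫ s in c..d, frozen h g c d s * deriv g s = K (g d - g c) := by
    rw [intervalIntegral.integral_congr_Ioo_of_le (g := fun s => h (g s - g c) * deriv g s) hcd
        fun s hs => by simp only [frozen_of_mem (Ioo_subset_Icc_self hs)],
      intervalIntegral.integral_eq_sub_of_hasDerivAt
        (fun s _ => (hK _).comp s ((hgd s).sub_const (g c)))
        (Continuous.intervalIntegrable (by fun_prop) c d)]
    simp [hK0]
  have after : ∫ s in d..1, frozen h g c d s * deriv g s = h (g d - g c) * (g 1 - g d) := by
    rw [intervalIntegral.integral_congr_Ioo_of_le (g := fun s => h (g d - g c) * deriv g s) hd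
        fun s hs => by simp only [frozen_of_ge hcd hs.1.le],
      intervalIntegral.integral_const_mul,
      intervalIntegral.integral_eq_sub_of_hasDerivAt (fun s _ => hgd s)
        (hg'.intervalIntegrable d 1)]
  rw [← intervalIntegral.integral_add_adjacent_intervals (integrable 0 c) (integrable c 1),
    ← intervalIntegral.integral_add_adjacent_intervals (integrable c d) (integrable d 1),
    before, during, after, zero_add]

lemma glsIntegral_frozen (hβ0 : 0 < β) (hβ1 : β < 1) (hβr : β < r) (hβr' : 1 - β < r)
    (hg : HolderWith C r g) (hc : 0 ≤ c) (hcd : c ≤ d) (hd : d ≤ 1)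
    (hK : ∀ x, HasDerivAt K (h x) x) (hh : LipschitzWith Λ h) (h0 : h 0 = 0) (hK0 : K 0 = 0) :
    glsIntegral β (frozen h g c d) g = K (g d - g c) + h (g d - g c) * (g 1 - g d) := by
  have hr : 0 < r := NNReal.coe_pos.1 (hβ0.trans hβr)
  have hgc : Continuous g := hg.continuous hr
  have hKc : Continuous K := continuous_iff_continuousAt.2 fun x => (hK x).continuousAt
  have hhc : Continuous h := hh.continuous
  let G : ℕ → ℝ → ℝ := fun n => steklov (1 / ((n : ℝ) + 1)) g
  have hη : ∀ n : ℕ, 1 / ((n : ℝ) + 1) ≠ 0 := fun n => by positivity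
  have hG : ∀ n, HolderWith C r (G n) := fun n => holderWith_steklov hg hr _
  have hGlim : ∀ x, Tendsto (fun n => G n x) atTop (𝓝 (g x)) := tendsto_steklov hgc
  have value : ∀ n, glsIntegral β (frozen h (G n) c d) (G n)
      = K (G n d - G n c) + h (G n d - G n c) * (G n 1 - G n d) := fun n => by
    have hL := lipschitzWith_steklov hg hr (hη n)
    rw [glsIntegral_eq_integral_mul_deriv hβ0 hβ1
      (holderWith_one.1 (holderWith_frozen (holderWith_one.2 hL) hh c d)) (frozen_of_le h0 hc) hL,
      integral_frozen_mul_deriv hc hcd hd hK hhc h0 hK0 (contDiff_steklov hgc (hη n))]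
  have tendsto_value : Tendsto (fun n => K (G n d - G n c) + h (G n d - G n c) * (G n 1 - G n d))
      atTop (𝓝 (K (g d - g c) + h (g d - g c) * (g 1 - g d))) := by
    have hdc := (hGlim d).sub (hGlim c)
    exact ((hKc.tendsto _).comp hdc).add
      (((hhc.tendsto _).comp hdc).mul ((hGlim 1).sub (hGlim d)))
  refine tendsto_nhds_unique (tendsto_glsIntegral hβ0 hβ1 hβr hβr'
    (fun n => holderWith_frozen (hG n) hh c d) (fun n => frozen_of_le h0 hc) hG
    (fun x => (hhc.tendsto _).comp ((hGlim _).sub (hGlim _))) hGlim) ?_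
  simpa only [value] using tendsto_value

end Frozen

lemma leftDeriv_eq_marchaud (β : ℝ) (f : ℝ → ℝ) (x : ℝ) :
    leftDeriv β 0 f x = 1 / Real.Gamma (1 - β) * marchaud β f x := by
  simp only [leftDeriv, marchaud, sub_zero]

lemma rightDeriv_eq_marchaud (β : ℝ) (g : ℝ → ℝ) (x : ℝ) :
    rightDeriv β 1 (fun x => g x - g 1) x =
      Complex.exp (Complex.I * Real.pi * (1 - β)) / (Real.Gamma β : ℂ) *
        (marchaud (1 - β) (reflect g) (1 - x) : ℝ) := by
  have integral_eq : ∫ u in x..1, (g x - g 1 - (g u - g 1)) / (u - x) ^ (2 - β)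
      = ∫ u in (0 : ℝ)..(1 - x),
          (reflect g (1 - x) - reflect g u) / (1 - x - u) ^ (1 - β + 1) := by
    have := intervalIntegral.integral_comp_sub_left (a := (0 : ℝ)) (b := 1 - x)
      (fun u => (g x - g 1 - (g u - g 1)) / (u - x) ^ (2 - β)) 1
    rw [sub_sub_cancel, sub_zero] at this
    rw [← this]
    simp only [reflect, sub_sub_cancel, sub_right_comm, show 1 - β + 1 = 2 - β by ring]
  rw [rightDeriv, marchaud, integral_eq]
  simp only [reflect, sub_sub_cancel]

lemma integral_leftDeriv_mul_rightDeriv (β : ℝ) (f g : ℝ → ℝ) :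
    Complex.exp (Complex.I * Real.pi * β) *
        ∫ x in (0 : ℝ)..1, (leftDeriv β 0 f x : ℂ) * rightDeriv β 1 (fun x => g x - g 1) x
      = (glsIntegral β f g : ℂ) := by
  have integrand : ∀ x, (leftDeriv β 0 f x : ℂ) * rightDeriv β 1 (fun x => g x - g 1) x
      = Complex.exp (Complex.I * Real.pi * (1 - β)) / (Real.Gamma β * Real.Gamma (1 - β) : ℝ)
        * ((marchaud β f x * marchaud (1 - β) (reflect g) (1 - x) : ℝ) : ℂ) := fun x => by
    rw [leftDeriv_eq_marchaud, rightDeriv_eq_marchaud]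
    push_cast
    ring
  simp_rw [integrand]
  rw [intervalIntegral.integral_const_mul, intervalIntegral.integral_ofReal, ← mul_assoc,
    ← mul_div_assoc, ← Complex.exp_add,
    show Complex.I * Real.pi * β + Complex.I * Real.pi * (1 - β) = Real.pi * Complex.I by ring,
    Complex.exp_pi_mul_I, glsIntegral]
  push_cast
  ring

/-- The density at `t` of the norm `fracNorm β 0 1 f`; it dominates the Marchaud derivative. -/
def fracDensity (β : ℝ) (f : ℝ → ℝ) (t : ℝ) : ℝ≥0∞ :=
  ENNReal.ofReal (|f t| / t ^ β)
    + ∫⁻ s in Icc 0 t, ENNReal.ofReal (|f t - f s| / (t - s) ^ (β + 1))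

lemma fracNorm_eq_lintegral_fracDensity (β : ℝ) (f : ℝ → ℝ) :
    fracNorm β 0 1 f = ∫⁻ t in Ioo 0 1, fracDensity β f t := by
  simp only [fracNorm, fracDensity, sub_zero, ← restrict_Ioo_eq_restrict_Icc]

lemma measurable_fracDensity {f : ℝ → ℝ} (hf : Measurable f) (β : ℝ) :
    Measurable (fracDensity β f) := by
  have lintegral_eq :
      (fun t => ∫⁻ s in Icc 0 t, ENNReal.ofReal (|f t - f s| / (t - s) ^ (β + 1)))
      = fun t => ∫⁻ s, {z : ℝ × ℝ | 0 ≤ z.2 ∧ z.2 ≤ z.1}.indicator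
        (fun z => ENNReal.ofReal (|f z.1 - f z.2| / (z.1 - z.2) ^ (β + 1))) (t, s) := by
    ext t
    rw [← lintegral_indicator measurableSet_Icc]
    rfl
  refine Measurable.add (f := fun t => ENNReal.ofReal (|f t| / t ^ β)) (by fun_prop) ?_
  rw [lintegral_eq]
  refine Measurable.lintegral_prod_right' (ν := volume) (Measurable.indicator (by fun_prop) ?_)
  exact (measurableSet_le measurable_const measurable_snd).inter
    (measurableSet_le measurable_snd measurable_fst)

section FiniteNorm

variable {β : ℝ} {f : ℝ → ℝ}

lemma lintegral_enorm_increment_div_rpow (β : ℝ) (f : ℝ → ℝ) (t : ℝ) :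
    ∫⁻ s in Ioc 0 t, ‖(f t - f s) / (t - s) ^ (β + 1)‖ₑ
      = ∫⁻ s in Icc 0 t, ENNReal.ofReal (|f t - f s| / (t - s) ^ (β + 1)) := by
  rw [setLIntegral_congr Ioc_ae_eq_Icc]
  refine setLIntegral_congr_fun measurableSet_Icc fun s hs => ?_
  rw [Real.enorm_eq_ofReal_abs, abs_div,
    abs_of_nonneg (Real.rpow_nonneg (sub_nonneg.2 hs.2) _)]

lemma enorm_marchaud_le_fracDensity (hβ0 : 0 < β) (hβ1 : β < 1) (f : ℝ → ℝ) {t : ℝ}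
    (ht : 0 < t) : ‖marchaud β f t‖ₑ ≤ fracDensity β f t := by
  refine (enorm_add_le _ _).trans (add_le_add ?_ ?_)
  · rw [Real.enorm_eq_ofReal_abs, abs_div, abs_of_pos (Real.rpow_pos_of_pos ht β)]
  · rw [enorm_mul, ← lintegral_enorm_increment_div_rpow, intervalIntegral.integral_of_le ht.le]
    refine (mul_le_mul' (b := 1) ?_ (enorm_integral_le_lintegral_enorm _)).trans_eq (one_mul _)
    rw [Real.enorm_eq_ofReal_abs, abs_of_pos hβ0]
    exact ENNReal.ofReal_le_one.2 hβ1.le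

lemma integrableOn_increment_div_rpow (hf : Measurable f) {t : ℝ} (h : fracDensity β f t < ∞) :
    IntegrableOn (fun u => (f t - f u) / (t - u) ^ (β + 1)) (Ioc 0 t) := by
  refine ⟨(measurable_increment_div_rpow hf β t).aestronglyMeasurable, ?_⟩
  rw [HasFiniteIntegral, lintegral_enorm_increment_div_rpow]
  exact le_add_self.trans_lt h

lemma lintegral_enorm_marchaud_le (hβ0 : 0 < β) (hβ1 : β < 1) (f : ℝ → ℝ) :
    ∫⁻ t in Ioo 0 1, ‖marchaud β f t‖ₑ ≤ fracNorm β 0 1 f := by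
  rw [fracNorm_eq_lintegral_fracDensity]
  exact setLIntegral_mono' measurableSet_Ioo fun t ht =>
    enorm_marchaud_le_fracDensity hβ0 hβ1 f ht.1

lemma integrableOn_marchaud (hβ0 : 0 < β) (hβ1 : β < 1) (hf : Measurable f)
    (h : fracNorm β 0 1 f < ∞) : IntegrableOn (marchaud β f) (Ioo 0 1) :=
  ⟨(aestronglyMeasurable_marchaud hf β).mono_set Ioo_subset_Ioi_self,
    (lintegral_enorm_marchaud_le hβ0 hβ1 f).trans_lt h⟩

lemma integral_norm_marchaud_le (hβ0 : 0 < β) (hβ1 : β < 1) (hf : Measurable f)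
    (h : fracNorm β 0 1 f < ∞) :
    ∫ t in Ioo 0 1, ‖marchaud β f t‖ ≤ (fracNorm β 0 1 f).toReal := by
  rw [integral_norm_eq_lintegral_enorm
    (integrableOn_marchaud hβ0 hβ1 hf h).aestronglyMeasurable]
  exact ENNReal.toReal_mono h.ne (lintegral_enorm_marchaud_le hβ0 hβ1 f)

lemma ae_intervalIntegrable_increment_div_rpow (hf : Measurable f) (h : fracNorm β 0 1 f < ∞) :
    ∀ᵐ x ∂volume.restrict (Icc (0 : ℝ) 1),
      IntervalIntegrable (fun u => (f x - f u) / (x - u) ^ (β + 1)) volume 0 x := by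
  rw [fracNorm_eq_lintegral_fracDensity, restrict_Ioo_eq_restrict_Icc] at h
  filter_upwards [ae_lt_top (measurable_fracDensity hf β) h.ne,
    ae_restrict_mem measurableSet_Icc] with x hx hx01
  rw [intervalIntegrable_iff_integrableOn_Ioc_of_le hx01.1]
  exact integrableOn_increment_div_rpow hf hx

end FiniteNorm

section HolderIntegrator

variable {C r : ℝ≥0} {β : ℝ} {f g : ℝ → ℝ}

lemma intervalIntegrable_increment_div_rpow_right (hg : HolderWith C r g) (hr : 0 < r)
    (hβr : 1 - β < r) {x : ℝ} (hx : x ≤ 1) :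
    IntervalIntegrable (fun u => (g x - g u) / (u - x) ^ (2 - β)) volume x 1 := by
  have h := ((intervalIntegrable_increment_div_rpow (holderWith_reflect hg) hr hβr
    (sub_nonneg.2 hx)).comp_sub_left 1).symm
  simpa only [reflect, sub_zero, sub_sub_cancel, sub_sub_sub_cancel_right, sub_sub_sub_cancel_left,
    show 1 - β + 1 = 2 - β by ring] using h

lemma memLp_top_rightDeriv (hg : HolderWith C r g) (hr : 0 < r) (hβ1 : β < 1) (hβr : 1 - β < r) :
    MemLp (rightDeriv β 1 fun x => g x - g 1) ∞ (volume.restrict (Icc 0 1)) := by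
  rw [← restrict_Ioo_eq_restrict_Icc, funext (rightDeriv_eq_marchaud β g)]
  refine (MemLp.ofReal (K := ℂ) (memLp_top_of_bound
    (aestronglyMeasurable_marchaud_reflect (hg.continuous hr) β)
    (C * (1 + (1 - β) / (r - (1 - β)))) ?_)).const_mul _
  filter_upwards [ae_restrict_mem measurableSet_Ioo] with x hx
  exact abs_marchaud_reflect_le hg hβ1 hβr hx

lemma hasIntegral_glsIntegral (hβ0 : 0 < β) (hβ1 : β < 1) (hβr : 1 - β < r) (hf : Measurable f)
    (hfn : fracNorm β 0 1 f < ∞) (hg : HolderWith C r g) :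
    HasIntegral β 0 1 f g (glsIntegral β f g) where
  aemeasurable := hf.aemeasurable
  norm_lt_top := hfn
  left_integrable := ae_intervalIntegrable_increment_div_rpow hf hfn
  left_memLp := by
    rw [memLp_one_iff_integrable, ← restrict_Ioo_eq_restrict_Icc,
      funext (leftDeriv_eq_marchaud β f)]
    exact (integrableOn_marchaud hβ0 hβ1 hf hfn).const_mul _
  right_integrable := by
    filter_upwards [ae_restrict_mem measurableSet_Icc] with x hx
    exact intervalIntegrable_increment_div_rpow_right hg
      (NNReal.coe_pos.1 ((sub_pos.2 hβ1).trans hβr)) hβr hx.2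
  right_memLp := memLp_top_rightDeriv hg (NNReal.coe_pos.1 ((sub_pos.2 hβ1).trans hβr)) hβ1 hβr
  value := integral_leftDeriv_mul_rightDeriv β f g

end HolderIntegrator

section Series

variable {C r : ℝ≥0} {β : ℝ} {f g : ℝ → ℝ} {F : ℕ → ℝ → ℝ}

lemma fracDensity_le_tsum (hF : ∀ n, Measurable (F n))
    (hsum : ∀ x ∈ Ico (0 : ℝ) 1, HasSum (fun n => F n x) (f x)) {t : ℝ} (ht : t ∈ Ioo 0 1) :
    fracDensity β f t ≤ ∑' n, fracDensity β (F n) t := by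
  have abs_div_le_tsum : ∀ {a : ℕ → ℝ} {b p : ℝ}, 0 ≤ p → HasSum a b →
      ENNReal.ofReal (|b| / p) ≤ ∑' n, ENNReal.ofReal (|a n| / p) := fun {a b p} hp h => by
    have := (h.div_const p).tsum_eq ▸ enorm_tsum_le_tsum_enorm (f := fun n => a n / p)
    simpa only [Real.enorm_eq_ofReal_abs, abs_div, abs_of_nonneg hp] using this
  have hft := hsum t ⟨ht.1.le, ht.2⟩
  unfold fracDensity
  rw [ENNReal.tsum_add, ← lintegral_tsum fun n => Measurable.aemeasurable (by fun_prop)]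
  refine add_le_add (abs_div_le_tsum (Real.rpow_nonneg ht.1.le _) hft)
    (setLIntegral_mono' measurableSet_Icc fun s hs => ?_)
  exact abs_div_le_tsum (Real.rpow_nonneg (sub_nonneg.2 hs.2) _)
    (hft.sub (hsum s ⟨hs.1, hs.2.trans_lt ht.2⟩))

lemma tsum_fracNorm (hF : ∀ n, Measurable (F n)) :
    ∑' n, fracNorm β 0 1 (F n) = ∫⁻ t in Ioo (0 : ℝ) 1, ∑' n, fracDensity β (F n) t := by
  rw [lintegral_tsum fun n => (measurable_fracDensity (hF n) β).aemeasurable]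
  simp only [fracNorm_eq_lintegral_fracDensity]

lemma fracNorm_le_tsum (hF : ∀ n, Measurable (F n))
    (hsum : ∀ x ∈ Ico (0 : ℝ) 1, HasSum (fun n => F n x) (f x)) :
    fracNorm β 0 1 f ≤ ∑' n, fracNorm β 0 1 (F n) := by
  rw [tsum_fracNorm hF, fracNorm_eq_lintegral_fracDensity]
  exact setLIntegral_mono' measurableSet_Ioo fun t ht => fracDensity_le_tsum hF hsum ht

lemma hasSum_marchaud (hF : ∀ n, Measurable (F n))
    (hsum : ∀ x ∈ Ico (0 : ℝ) 1, HasSum (fun n => F n x) (f x)) {t : ℝ} (ht : t ∈ Ioo 0 1)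
    (hfin : ∑' n, fracDensity β (F n) t ≠ ∞) :
    HasSum (fun n => marchaud β (F n) t) (marchaud β f t) := by
  have hft := hsum t ⟨ht.1.le, ht.2⟩
  have hd : ∀ n, fracDensity β (F n) t < ∞ := fun n => (ENNReal.le_tsum n).trans_lt hfin.lt_top
  have norm_le : ∀ n, ∫ u in Ioc 0 t, ‖(F n t - F n u) / (t - u) ^ (β + 1)‖
      ≤ (fracDensity β (F n) t).toReal := fun n => by
    rw [integral_norm_eq_lintegral_enorm
      (measurable_increment_div_rpow (hF n) β t).aestronglyMeasurable,
      lintegral_enorm_increment_div_rpow]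
    exact ENNReal.toReal_mono (hd n).ne le_add_self
  have summable_norm : Summable fun n => ∫ u in Ioc 0 t, ‖(F n t - F n u) / (t - u) ^ (β + 1)‖ :=
    (ENNReal.summable_toReal hfin).of_nonneg_of_le
      (fun n => integral_nonneg fun _ => norm_nonneg _) norm_le
  refine (hft.div_const _).add (HasSum.mul_left β ?_)
  simp only [intervalIntegral.integral_of_le ht.1.le]
  rw [setIntegral_congr_fun measurableSet_Ioc fun u hu =>
    ((hft.sub (hsum u ⟨hu.1.le, hu.2.trans_lt ht.2⟩)).div_const _).tsum_eq.symm]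
  exact hasSum_integral_of_summable_integral_norm
    (fun n => integrableOn_increment_div_rpow (hF n) (hd n)) summable_norm

lemma hasSum_glsIntegral (hβ0 : 0 < β) (hβ1 : β < 1) (hβr : 1 - β < r)
    (hF : ∀ n, Measurable (F n)) (hg : HolderWith C r g)
    (hsum : ∀ x ∈ Ico (0 : ℝ) 1, HasSum (fun n => F n x) (f x))
    (hnorm : ∑' n, fracNorm β 0 1 (F n) ≠ ∞) :
    HasSum (fun n => glsIntegral β (F n) g) (glsIntegral β f g) := by
  have hr : 0 < r := NNReal.coe_pos.1 ((sub_pos.2 hβ1).trans hβr)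
  let R : ℝ → ℝ := fun x => marchaud (1 - β) (reflect g) (1 - x)
  let B : ℝ := C * (1 + (1 - β) / (r - (1 - β)))
  have hRm : AEStronglyMeasurable R (volume.restrict (Ioo 0 1)) :=
    aestronglyMeasurable_marchaud_reflect (hg.continuous hr) β
  have hRb : ∀ᵐ x ∂volume.restrict (Ioo (0 : ℝ) 1), ‖R x‖ ≤ B := by
    filter_upwards [ae_restrict_mem measurableSet_Ioo] with x hx
    exact abs_marchaud_reflect_le hg hβ1 hβr hx
  have hB : 0 ≤ B :=
    (abs_nonneg _).trans (abs_marchaud_reflect_le (x := 1 / 2) hg hβ1 hβr (by norm_num))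
  have hFn : ∀ n, fracNorm β 0 1 (F n) < ∞ := fun n =>
    (ENNReal.le_tsum n).trans_lt hnorm.lt_top
  have hint := fun n => integrableOn_marchaud hβ0 hβ1 (hF n) (hFn n)
  have norm_le : ∀ n, ∫ x in Ioo 0 1, ‖marchaud β (F n) x * R x‖
      ≤ (fracNorm β 0 1 (F n)).toReal * B := fun n => by
    refine (integral_mono_ae ((hint n).mul_bdd hRm hRb).norm ((hint n).norm.mul_const B) ?_).trans
      ((integral_mul_const B _).trans_le (mul_le_mul_of_nonneg_right
        (integral_norm_marchaud_le hβ0 hβ1 (hF n) (hFn n)) hB))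
    filter_upwards [hRb] with x hx
    rw [norm_mul]
    gcongr
  have tsum_eq : (fun x => ∑' n, marchaud β (F n) x * R x)
      =ᵐ[volume.restrict (Ioo 0 1)] fun x => marchaud β f x * R x := by
    have hfin := ae_lt_top (Measurable.tsum fun n => measurable_fracDensity (hF n) β)
      (tsum_fracNorm hF ▸ hnorm)
    filter_upwards [hfin, ae_restrict_mem measurableSet_Ioo] with x hx hx01
    exact ((hasSum_marchaud hF hsum hx01 hx.ne).mul_right (R x)).tsum_eq
  refine HasSum.mul_left _ ?_
  simp only [intervalIntegral.integral_of_le zero_le_one, integral_Ioc_eq_integral_Ioo]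
  rw [← integral_congr_ae tsum_eq]
  exact hasSum_integral_of_summable_integral_norm (fun n => (hint n).mul_bdd hRm hRb)
    (((ENNReal.summable_toReal hnorm).mul_right B).of_nonneg_of_le
      (fun n => integral_nonneg fun _ => norm_nonneg _) norm_le)

end Series

section Cutoff

variable {L r : ℝ≥0} {β Δ : ℝ} {f : ℝ → ℝ}

/-- The kernel that dominates the increments `|f t - f (t - u)| / u ^ (β + 1)` of an `r`-Hölder
function with constant `L` that varies only on an interval of length `Δ`. -/
def cutKernel (L Δ r β : ℝ) : ℝ → ℝ≥0∞ :=
  (Ioi (0 : ℝ)).indicator fun u => ENNReal.ofReal (L * min u Δ ^ r / u ^ (β + 1))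

lemma measurable_cutKernel (L Δ r β : ℝ) : Measurable (cutKernel L Δ r β) :=
  Measurable.indicator (by fun_prop) measurableSet_Ioi

lemma lintegral_rpow_Ioc {s : ℝ} (hs : -1 < s) (hΔ : 0 ≤ Δ) :
    ∫⁻ u in Ioc 0 Δ, ENNReal.ofReal (u ^ s) = ENNReal.ofReal (Δ ^ (s + 1) / (s + 1)) := by
  have hint : IntegrableOn (fun u : ℝ => u ^ s) (Ioc 0 Δ) := by
    rw [← intervalIntegrable_iff_integrableOn_Ioc_of_le hΔ]
    exact intervalIntegral.intervalIntegrable_rpow' hs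
  rw [← ofReal_integral_eq_lintegral_ofReal hint
    ((ae_restrict_mem measurableSet_Ioc).mono fun u hu => Real.rpow_nonneg hu.1.le s),
    ← intervalIntegral.integral_of_le hΔ, integral_rpow (Or.inl hs),
    Real.zero_rpow (by linarith), sub_zero]

lemma lintegral_rpow_Ioi {s : ℝ} (hs : s < -1) (hΔ : 0 < Δ) :
    ∫⁻ u in Ioi Δ, ENNReal.ofReal (u ^ s) = ENNReal.ofReal (-Δ ^ (s + 1) / (s + 1)) := by
  rw [← ofReal_integral_eq_lintegral_ofReal (integrableOn_Ioi_rpow_of_lt hs hΔ)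
    ((ae_restrict_mem measurableSet_Ioi).mono fun u hu =>
      Real.rpow_nonneg (hΔ.trans (mem_Ioi.1 hu)).le s), integral_Ioi_rpow_of_lt hs hΔ]

lemma lintegral_cutKernel {L r : ℝ} (hL : 0 ≤ L) (hΔ : 0 < Δ) (hβ0 : 0 < β) (hβr : β < r) :
    ∫⁻ u, cutKernel L Δ r β u = ENNReal.ofReal (L * Δ ^ (r - β) * (1 / (r - β) + 1 / β)) := by
  have : 0 < r - β := sub_pos.2 hβr
  have near : ∫⁻ u in Ioc 0 Δ, ENNReal.ofReal (L * min u Δ ^ r / u ^ (β + 1))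
      = ENNReal.ofReal (L * Δ ^ (r - β) * (1 / (r - β))) := by
    rw [setLIntegral_congr_fun measurableSet_Ioc
      (g := fun u => ENNReal.ofReal L * ENNReal.ofReal (u ^ (r - (β + 1)))) fun u hu => by
        simp only [min_eq_left hu.2, mul_div_assoc, ← Real.rpow_sub hu.1, ENNReal.ofReal_mul hL],
      lintegral_const_mul' _ _ ENNReal.ofReal_ne_top, lintegral_rpow_Ioc (by linarith) hΔ.le,
      ← ENNReal.ofReal_mul hL, show r - (β + 1) + 1 = r - β by ring]
    ring_nf
  have far : ∫⁻ u in Ioi Δ, ENNReal.ofReal (L * min u Δ ^ r / u ^ (β + 1))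
      = ENNReal.ofReal (L * Δ ^ (r - β) * (1 / β)) := by
    have hLΔ : 0 ≤ L * Δ ^ r := mul_nonneg hL (Real.rpow_nonneg hΔ.le _)
    rw [setLIntegral_congr_fun measurableSet_Ioi
      (g := fun u => ENNReal.ofReal (L * Δ ^ r) * ENNReal.ofReal (u ^ (-(β + 1)))) fun u hu => by
        simp only [min_eq_right ((mem_Ioi.1 hu).le), div_eq_mul_inv,
          ← Real.rpow_neg (hΔ.trans (mem_Ioi.1 hu)).le, ENNReal.ofReal_mul hLΔ],
      lintegral_const_mul' _ _ ENNReal.ofReal_ne_top, lintegral_rpow_Ioi (by linarith) hΔ,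
      ← ENNReal.ofReal_mul hLΔ, show -(β + 1) + 1 = -β by ring, sub_eq_add_neg r β,
      Real.rpow_add hΔ]
    ring_nf
  rw [cutKernel, lintegral_indicator measurableSet_Ioi, ← Ioc_union_Ioi_eq_Ioi hΔ.le,
    lintegral_union measurableSet_Ioi (Ioc_disjoint_Ioi le_rfl), near, far,
    ← ENNReal.ofReal_add (by positivity) (by positivity), mul_add]

lemma ofReal_increment_div_rpow_le_cutKernel {L r s t : ℝ} (hst : s ≤ t)
    (h : |f t - f s| ≤ L * min (t - s) Δ ^ r) :
    ENNReal.ofReal (|f t - f s| / (t - s) ^ (β + 1)) ≤ cutKernel L Δ r β (t - s) := by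
  rcases hst.eq_or_lt with rfl | hst
  · simp
  · rw [cutKernel, indicator_of_mem (mem_Ioi.2 (sub_pos.2 hst))]
    exact ENNReal.ofReal_le_ofReal (div_le_div_of_nonneg_right h
      (Real.rpow_nonneg (sub_pos.2 hst).le _))

lemma fracDensity_le_of_holderWith (hf : HolderWith L r f) (h0 : f 0 = 0) (hβ0 : 0 < β)
    (hβr : β < r) {t : ℝ} (ht : t ∈ Ioo 0 1) :
    fracDensity β f t ≤ ENNReal.ofReal L + ENNReal.ofReal (L * (1 / (r - β) + 1 / β)) := by
  have kernel := lintegral_cutKernel (Δ := 1) L.coe_nonneg one_pos hβ0 hβr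
  rw [Real.one_rpow, mul_one, ← lintegral_sub_left_eq_self (cutKernel L 1 r β) t] at kernel
  refine add_le_add (ENNReal.ofReal_le_ofReal ?_) (kernel ▸
    (setLIntegral_mono' measurableSet_Icc fun s hs => ?_).trans
      (setLIntegral_le_lintegral (Icc 0 t) _))
  · have h1 : |f t| ≤ L * t ^ (r : ℝ) := by
      simpa only [h0, sub_zero, abs_of_pos ht.1] using abs_sub_le_of_holderWith hf 0 t
    calc |f t| / t ^ β ≤ L * t ^ (r : ℝ) / t ^ β :=
          div_le_div_of_nonneg_right h1 (Real.rpow_nonneg ht.1.le β)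
      _ = L * t ^ (r - β) := by rw [mul_div_assoc, Real.rpow_sub ht.1]
      _ ≤ L := mul_le_of_le_one_right L.coe_nonneg
        (Real.rpow_le_one ht.1.le ht.2.le (sub_pos.2 hβr).le)
  · refine ofReal_increment_div_rpow_le_cutKernel hs.2 ?_
    rw [min_eq_left (by linarith [hs.1, ht.2])]
    simpa only [abs_of_nonneg (sub_nonneg.2 hs.2)] using abs_sub_le_of_holderWith hf s t

lemma fracNorm_lt_top_of_holderWith (hf : HolderWith L r f) (h0 : f 0 = 0) (hβ0 : 0 < β)
    (hβr : β < r) : fracNorm β 0 1 f < ∞ := by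
  rw [fracNorm_eq_lintegral_fracDensity]
  refine (setLIntegral_mono' measurableSet_Ioo fun t ht =>
    fracDensity_le_of_holderWith hf h0 hβ0 hβr ht).trans_lt ?_
  rw [setLIntegral_const, Real.volume_Ioo]
  finiteness

end Cutoff

section ShortSupport

variable {L r : ℝ≥0} {β c d : ℝ} {f : ℝ → ℝ}

lemma abs_sub_le_of_support (hf : HolderWith L r f) (hcd : c ≤ d) (hf0 : ∀ s ∉ Ioo c d, f s = 0)
    {s t : ℝ} (hst : s ≤ t) : |f t - f s| ≤ L * min (t - s) (d - c) ^ (r : ℝ) := by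
  have eq_clamp : ∀ u, f u = f (max c (min d u)) := fun u => by
    by_cases hu : u ∈ Ioo c d
    · rw [min_eq_right hu.2.le, max_eq_right hu.1.le]
    · rw [hf0 u hu, hf0]
      rcases lt_or_ge c u with h | h
      · rw [min_eq_left (not_lt.1 fun h' => hu ⟨h, h'⟩), max_eq_right hcd]
        exact fun h' => lt_irrefl d h'.2
      · rw [max_eq_left ((min_le_right d u).trans h)]
        exact fun h' => lt_irrefl c h'.1
  have clamp_le : |max c (min d t) - max c (min d s)| ≤ min (t - s) (d - c) := by
    have hmono : max c (min d s) ≤ max c (min d t) := by gcongr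
    rw [abs_of_nonneg (sub_nonneg.2 hmono)]
    refine le_min ?_ (sub_le_sub (max_le hcd (min_le_left _ _)) (le_max_left _ _))
    grind
  rw [eq_clamp t, eq_clamp s]
  exact (abs_sub_le_of_holderWith hf _ _).trans (by gcongr)

lemma abs_le_of_support (hf : HolderWith L r f) (hcd : c ≤ d) (hf0 : ∀ s ∉ Ioo c d, f s = 0)
    (t : ℝ) : |f t| ≤ L * (d - c) ^ (r : ℝ) := by
  have hdc : 0 ≤ d - c := sub_nonneg.2 hcd
  by_cases ht : t ∈ Ioo c d
  · have h := abs_sub_le_of_support hf hcd hf0 ht.1.le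
    rw [hf0 c fun h' => lt_irrefl c h'.1, sub_zero] at h
    have h0 : 0 ≤ min (t - c) (d - c) := le_min (sub_nonneg.2 ht.1.le) hdc
    exact h.trans (by gcongr; exact min_le_right _ _)
  · rw [hf0 t ht, abs_zero]
    positivity

lemma abs_div_rpow_le_of_support (hf : HolderWith L r f) (hβ0 : 0 < β) (hβ1 : β < 1)
    (hc : 1 / 2 ≤ c) (hcd : c ≤ d) (hf0 : ∀ s ∉ Ioo c d, f s = 0) {t : ℝ} (ht : c ≤ t) :
    |f t| / t ^ β ≤ 2 * (L * (d - c) ^ (r : ℝ)) := by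
  have half_le : (1 : ℝ) / 2 ≤ t ^ β :=
    calc (1 : ℝ) / 2 = (1 / 2) ^ (1 : ℝ) := (Real.rpow_one _).symm
      _ ≤ (1 / 2) ^ β := Real.rpow_le_rpow_of_exponent_ge (by norm_num) (by norm_num) hβ1.le
      _ ≤ t ^ β := Real.rpow_le_rpow (by norm_num) (hc.trans ht) hβ0.le
  rw [div_le_iff₀ (by linarith)]
  nlinarith [abs_le_of_support hf hcd hf0 t, abs_nonneg (f t)]

lemma fracDensity_le_of_support (hf : HolderWith L r f) (hβ0 : 0 < β) (hβ1 : β < 1)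
    (hc : 1 / 2 ≤ c) (hcd : c ≤ d) (hf0 : ∀ s ∉ Ioo c d, f s = 0) (t : ℝ) :
    fracDensity β f t
      ≤ (Ioo c d).indicator 1 t * ENNReal.ofReal (2 * (L * (d - c) ^ (r : ℝ)))
        + ((Ioo c d).indicator 1 t * (∫⁻ u, cutKernel L (d - c) r β u)
          + ∫⁻ s, (Ioo c d).indicator 1 s * cutKernel L (d - c) r β (t - s)) := by
  refine add_le_add ?_ ?_
  · by_cases ht : t ∈ Ioo c d
    · rw [indicator_of_mem ht, Pi.one_apply, one_mul]
      exact ENNReal.ofReal_le_ofReal (abs_div_rpow_le_of_support hf hβ0 hβ1 hc hcd hf0 ht.1.le)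
    · simp [hf0 t ht]
  have hk : Measurable fun s => cutKernel L (d - c) r β (t - s) :=
    (measurable_cutKernel _ _ _ _).comp (by fun_prop)
  rw [← lintegral_sub_left_eq_self (cutKernel L (d - c) r β) t, ← lintegral_const_mul _ hk,
    ← lintegral_add_left (hk.const_mul _)]
  refine (setLIntegral_mono' measurableSet_Icc fun s hs => ?_).trans
    (setLIntegral_le_lintegral (Icc 0 t) _)
  have increment := ofReal_increment_div_rpow_le_cutKernel (β := β) hs.2
    (abs_sub_le_of_support hf hcd hf0 hs.2)
  by_cases ht : t ∈ Ioo c d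
  · rw [indicator_of_mem ht, Pi.one_apply, one_mul]
    exact increment.trans le_self_add
  by_cases hs' : s ∈ Ioo c d
  · rw [indicator_of_mem hs', Pi.one_apply, one_mul]
    exact increment.trans le_add_self
  · simp [hf0 t ht, hf0 s hs']

lemma lintegral_lintegral_indicator_mul_sub {k : ℝ → ℝ≥0∞} (hk : Measurable k) {S : Set ℝ}
    (hS : MeasurableSet S) :
    ∫⁻ t, ∫⁻ s, S.indicator 1 s * k (t - s) = volume S * ∫⁻ u, k u := by
  have hind : Measurable (S.indicator (1 : ℝ → ℝ≥0∞)) := measurable_one.indicator hS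
  rw [lintegral_lintegral_swap (Measurable.aemeasurable (by fun_prop)),
    ← lintegral_indicator_one hS, ← lintegral_mul_const _ hind]
  refine lintegral_congr fun s => ?_
  rw [lintegral_const_mul _ (by fun_prop), lintegral_sub_right_eq_self k]

lemma fracNorm_le_of_support (hf : HolderWith L r f) (hβ0 : 0 < β) (hβ1 : β < 1) (hβr : β < r)
    (hc : 1 / 2 ≤ c) (hcd : c < d) (hd : d ≤ 1) (hf0 : ∀ s ∉ Ioo c d, f s = 0) :
    fracNorm β 0 1 f
      ≤ ENNReal.ofReal ((2 + 2 * (1 / (r - β) + 1 / β)) * L * (d - c) ^ (1 + r - β)) := by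
  have : 0 < r - β := sub_pos.2 hβr
  have hk := measurable_cutKernel L (d - c) r β
  have hind : Measurable ((Ioo c d).indicator (1 : ℝ → ℝ≥0∞)) :=
    measurable_one.indicator measurableSet_Ioo
  have lintegral_ind : ∫⁻ t, (Ioo c d).indicator 1 t = ENNReal.ofReal (d - c) := by
    rw [lintegral_indicator_one measurableSet_Ioo, Real.volume_Ioo]
  have hΔ : 0 < d - c := sub_pos.2 hcd
  have rpow_le : (d - c) ^ (r : ℝ) ≤ (d - c) ^ (r - β) :=
    Real.rpow_le_rpow_of_exponent_ge hΔ (by linarith) (by linarith)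
  rw [fracNorm_eq_lintegral_fracDensity]
  refine (setLIntegral_le_lintegral _ _).trans ((lintegral_mono fun t =>
    fracDensity_le_of_support hf hβ0 hβ1 hc hcd.le hf0 t).trans ?_)
  rw [lintegral_add_left (hind.mul_const _), lintegral_add_left (hind.mul_const _),
    lintegral_mul_const _ hind, lintegral_mul_const _ hind, lintegral_ind,
    lintegral_lintegral_indicator_mul_sub hk measurableSet_Ioo, Real.volume_Ioo,
    lintegral_cutKernel L.coe_nonneg hΔ hβ0 hβr, ← ENNReal.ofReal_mul hΔ.le,
    ← ENNReal.ofReal_mul hΔ.le, ← ENNReal.ofReal_add (by positivity) (by positivity),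
    ← ENNReal.ofReal_add (by positivity) (by positivity)]
  refine ENNReal.ofReal_le_ofReal ?_
  calc (d - c) * (2 * (L * (d - c) ^ (r : ℝ)))
        + ((d - c) * (L * (d - c) ^ (r - β) * (1 / (r - β) + 1 / β))
          + (d - c) * (L * (d - c) ^ (r - β) * (1 / (r - β) + 1 / β)))
      ≤ (d - c) * (2 * (L * (d - c) ^ (r - β)))
        + ((d - c) * (L * (d - c) ^ (r - β) * (1 / (r - β) + 1 / β))
          + (d - c) * (L * (d - c) ^ (r - β) * (1 / (r - β) + 1 / β))) := by gcongr
    _ = (2 + 2 * (1 / (r - β) + 1 / β)) * L * (d - c) ^ (1 + r - β) := by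
      rw [add_sub_assoc, Real.rpow_add hΔ, Real.rpow_one]
      ring

end ShortSupport

/-- The integral over a block as a function of the displacement of the path: it grows from `0` to
`1`, and stays equal to `1` once the path has moved by `ε`. -/
def profile (ε x : ℝ) : ℝ := Real.smoothTransition ((x / ε) ^ 2)

/-- The integrand of a block as a function of the displacement of the path. -/
def bump (ε : ℝ) : ℝ → ℝ := deriv (profile ε)

section Bump

variable {ε x : ℝ}

lemma contDiff_profile (ε : ℝ) {n : ℕ∞} : ContDiff ℝ n (profile ε) :=
  Real.smoothTransition.contDiff.comp ((contDiff_id.div_const ε).pow 2)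

lemma hasDerivAt_profile (ε x : ℝ) : HasDerivAt (profile ε) (bump ε x) x :=
  ((contDiff_profile ε (n := 1)).differentiable one_ne_zero x).hasDerivAt

lemma contDiff_bump (ε : ℝ) : ContDiff ℝ 1 (bump ε) :=
  (contDiff_succ_iff_deriv (n := 1).1 (contDiff_profile ε (n := 2))).2.2

lemma profile_zero (ε : ℝ) : profile ε 0 = 0 := by simp [profile]

lemma profile_of_le (hε : 0 < ε) (hx : ε ≤ |x|) : profile ε x = 1 :=
  Real.smoothTransition.one_of_one_le <| (one_le_sq_iff_one_le_abs _).2 <| by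
    rwa [abs_div, abs_of_pos hε, one_le_div hε]

lemma bump_zero (ε : ℝ) : bump ε 0 = 0 :=
  IsLocalMin.deriv_eq_zero <| Eventually.of_forall fun y => by
    rw [profile_zero]
    exact Real.smoothTransition.nonneg _

lemma bump_of_le (hε : 0 < ε) (hx : ε ≤ |x|) : bump ε x = 0 :=
  IsLocalMax.deriv_eq_zero <| Eventually.of_forall fun y => by
    rw [profile_of_le hε hx]
    exact Real.smoothTransition.le_one _

lemma bump_eq_inv_mul (ε x : ℝ) : bump ε x = ε⁻¹ * bump 1 (ε⁻¹ * x) := by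
  have scale : profile ε = fun y => profile 1 (ε⁻¹ * y) := by
    funext y
    rw [profile, profile, div_one, div_eq_inv_mul]
  rw [bump, scale, deriv_comp_mul_left, smul_eq_mul, bump]

lemma exists_lipschitzWith_bump : ∃ L : ℝ≥0, ∀ ε, LipschitzWith (L / ‖ε‖₊ ^ 2) (bump ε) := by
  have compact : HasCompactSupport (bump 1) :=
    HasCompactSupport.intro (isCompact_Icc (a := (-1 : ℝ)) (b := 1)) fun x hx =>
      bump_of_le one_pos <| not_lt.1 fun h => hx (abs_le.1 h.le)
  obtain ⟨L, hL⟩ :=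
    ContDiff.lipschitzWith_of_hasCompactSupport compact (contDiff_bump 1) one_ne_zero
  refine ⟨L, fun ε => ?_⟩
  have const : ‖ε⁻¹‖₊ * (L * ‖ε⁻¹‖₊) = L / ‖ε‖₊ ^ 2 := by
    rw [nnnorm_inv]
    field_simp
  rw [funext (bump_eq_inv_mul ε), ← const]
  exact (lipschitzWith_smul ε⁻¹).comp (hL.comp (lipschitzWith_smul ε⁻¹))

end Bump

/-- The path `x` on `[0, 1]`, extended to the real line by its end values. -/
abbrev extend (x : I → ℝ) : ℝ → ℝ := IccExtend zero_le_one x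

lemma extend_coe (x : I → ℝ) (t : I) : extend x t = x t := IccExtend_val _ _ _

/-- By the time `t` the path `x` has moved by at least `ε` away from its position at time `c`. Only
the times of a fixed dense sequence are inspected: this makes the event measurable with respect to
`𝓕 t`, even where the paths are not continuous. -/
def Hit (x : I → ℝ) (ε : ℝ) (c t : I) : Prop :=
  ∃ k, denseSeq I k ∈ Icc c t ∧ ε ≤ |x (denseSeq I k) - x c|

open Classical in
/-- The elementary integrand on `[c, d]`: it follows `bump ε (x - x c)` until the path has moved
by `ε`, then it vanishes. If this does not happen before `d`, it is frozen from `d` on. -/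
def block (x : I → ℝ) (ε : ℝ) (c d t : I) : ℝ :=
  if c ≤ t ∧ ¬Hit x ε c (min t d) then bump ε (x (min t d) - x c) else 0

open Classical in
/-- The integral of `block x ε c d` over `[0, d]`. -/
def blockValue (x : I → ℝ) (ε : ℝ) (c d : I) : ℝ :=
  if Hit x ε c d then 1 else profile ε (x d - x c)

/-- The time at which the path has first moved by `ε` since time `c`, or `d` if that is earlier. -/
def hitTime (x : I → ℝ) (ε : ℝ) (c d : I) : I :=
  min d (sInf {u | ∃ k, denseSeq I k = u ∧ c ≤ u ∧ ε ≤ |x u - x c|})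

section Block

variable {x : I → ℝ} {ε : ℝ} {c d t : I}

lemma Hit.mono {u : I} (h : Hit x ε c t) (htu : t ≤ u) : Hit x ε c u :=
  have ⟨k, hk, hε⟩ := h
  ⟨k, Icc_subset_Icc_right htu hk, hε⟩

lemma hit_of_exists_lt (hx : Continuous x) (hcd : c < d) (h : ∃ u ∈ Icc c d, ε < |x u - x c|) :
    Hit x ε c d := by
  obtain ⟨u, hu, hux⟩ := h
  have isOpen : IsOpen {v : I | ε < |x v - x c|} := isOpen_lt continuous_const (by fun_prop)
  rw [← closure_Ioo hcd.ne, mem_closure_iff] at hu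
  obtain ⟨k, hk, hkcd⟩ :=
    (denseRange_denseSeq I).exists_mem_open (isOpen.inter isOpen_Ioo) (hu _ isOpen hux)
  exact ⟨k, Ioo_subset_Icc_self hkcd, le_of_lt hk⟩

lemma le_hitTime (hcd : c ≤ d) : c ≤ hitTime x ε c d :=
  le_min hcd (le_sInf fun _ ⟨_, _, h, _⟩ => h)

lemma hitTime_le : hitTime x ε c d ≤ d := min_le_left _ _

lemma le_hitTime_of_not_hit (htd : t ≤ d) (h : ¬Hit x ε c t) : t ≤ hitTime x ε c d :=
  le_min htd <| le_sInf fun _ ⟨k, hk, hc, hε⟩ => le_of_not_ge fun hkt =>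
    h ⟨k, hk ▸ ⟨hc, hkt⟩, hk ▸ hε⟩

lemma hitTime_le_of_hit (h : Hit x ε c t) : hitTime x ε c d ≤ t :=
  have ⟨k, hk, hε⟩ := h
  (min_le_right _ _).trans <| sInf_le_of_le ⟨k, rfl, hk.1, hε⟩ hk.2

lemma le_abs_hitTime_of_hit (hx : Continuous x) (h : Hit x ε c d) :
    ε ≤ |x (hitTime x ε c d) - x c| := by
  obtain ⟨k, hk, hε⟩ := h
  set S := {u | ∃ k, denseSeq I k = u ∧ c ≤ u ∧ ε ≤ |x u - x c|} with hS
  have mem : denseSeq I k ∈ S := ⟨k, rfl, hk.1, hε⟩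
  have isClosed : IsClosed {u | ε ≤ |x u - x c|} := isClosed_le continuous_const (by fun_prop)
  have subset : S ⊆ {u | ε ≤ |x u - x c|} := fun _ ⟨_, _, _, hu⟩ => hu
  rw [hitTime, ← hS, min_eq_right ((sInf_le mem).trans hk.2)]
  exact closure_minimal subset isClosed (sInf_mem_closure ⟨_, mem⟩)

lemma block_of_le (hcd : c ≤ d) (htc : t ≤ c) : block x ε c d t = 0 := by
  rw [block]
  split_ifs with h
  · rw [min_eq_left (htc.trans hcd), le_antisymm htc h.1, sub_self, bump_zero]
  · rfl

lemma block_eq_frozen (hx : Continuous x) (hε : 0 < ε) (hcd : c ≤ d) (t : I) :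
    block x ε c d t = frozen (bump ε) (extend x) c (hitTime x ε c d) t := by
  have hcτ : (c : ℝ) ≤ hitTime x ε c d := le_hitTime hcd
  rcases le_total t c with htc | hct
  · rw [frozen_of_le (bump_zero ε) htc, block_of_le hcd htc]
  by_cases h : Hit x ε c (min t d)
  · have hτt : (hitTime x ε c d : ℝ) ≤ t := (hitTime_le_of_hit h).trans (min_le_left t d)
    have hit : Hit x ε c d := h.mono (min_le_right t d)
    rw [frozen_of_ge hcτ hτt, extend_coe, extend_coe,
      bump_of_le hε (le_abs_hitTime_of_hit hx hit), block, if_neg fun h' => h'.2 h]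
  · have min_hitTime : min t (hitTime x ε c d) = min t d :=
      le_antisymm (min_le_min_left t hitTime_le)
        (le_min (min_le_left t d) (le_hitTime_of_not_hit (min_le_right t d) h))
    have clamp : max (c : ℝ) (min (hitTime x ε c d) t) = (min t d : I) := by
      rw [min_comm, ← min_hitTime]
      exact max_eq_right (le_min hct hcτ)
    rw [block, if_pos ⟨hct, h⟩, frozen, clamp, extend_coe, extend_coe]

lemma blockValue_add_block_mul (hx : Continuous x) (hε : 0 < ε) (hcd : c ≤ d) :
    blockValue x ε c d + block x ε c d d * (x 1 - x d)
      = profile ε (x (hitTime x ε c d) - x c)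
        + bump ε (x (hitTime x ε c d) - x c) * (x 1 - x (hitTime x ε c d)) := by
  rw [blockValue, block, min_self]
  by_cases h : Hit x ε c d
  · have hτ := le_abs_hitTime_of_hit hx h
    rw [if_pos h, if_neg fun h' => h'.2 h, profile_of_le hε hτ, bump_of_le hε hτ, zero_mul,
      zero_mul]
  · rw [if_neg h, if_pos ⟨hcd, h⟩, le_antisymm hitTime_le (le_hitTime_of_not_hit le_rfl h)]

end Block

/-- The grid of times `1 - 2 ^ (-(n + 1))`. -/
def gridTime (n : ℕ) : I :=
  σ ⟨(1 / 2) ^ (n + 1), by positivity, pow_le_one₀ (by norm_num) (by norm_num)⟩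

/-- The mesh `gridTime (n + 1) - gridTime n`. -/
def gridStep (n : ℕ) : ℝ := (1 / 2) ^ (n + 2)

section Grid

lemma coe_gridTime (n : ℕ) : (gridTime n : ℝ) = 1 - (1 / 2) ^ (n + 1) := rfl

lemma gridStep_pos (n : ℕ) : 0 < gridStep n := by unfold gridStep; positivity

lemma gridStep_le_one (n : ℕ) : gridStep n ≤ 1 := pow_le_one₀ (by norm_num) (by norm_num)

lemma gridStep_eq_two_mul (n : ℕ) : gridStep n = 2 * gridStep (n + 1) := by
  unfold gridStep; ring

lemma gridTime_succ_sub (n : ℕ) : (gridTime (n + 1) : ℝ) - gridTime n = gridStep n := by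
  rw [coe_gridTime, coe_gridTime, gridStep]; ring

lemma strictMono_gridTime : StrictMono gridTime :=
  strictMono_nat_of_lt_succ fun n => Subtype.coe_lt_coe.1 <|
    sub_pos.1 ((gridStep_pos n).trans_eq (gridTime_succ_sub n).symm)

lemma gridTime_le_succ (n : ℕ) : gridTime n ≤ gridTime (n + 1) :=
  strictMono_gridTime.monotone n.le_succ

lemma half_le_gridTime (n : ℕ) : 1 / 2 ≤ (gridTime n : ℝ) := by
  rw [coe_gridTime, pow_succ]
  linarith [pow_le_one₀ (n := n) (by norm_num : (0 : ℝ) ≤ 1 / 2) (by norm_num)]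

lemma tendsto_gridTime : Tendsto gridTime atTop (𝓝 1) := by
  rw [tendsto_subtype_rng]
  have h := (tendsto_pow_atTop_nhds_zero_of_lt_one (by norm_num : (0 : ℝ) ≤ 1 / 2)
    (by norm_num)).comp (tendsto_add_atTop_nat 1)
  simpa only [sub_zero] using! h.const_sub 1

lemma summable_gridStep_rpow {θ : ℝ} (hθ : 0 < θ) : Summable fun n => gridStep n ^ θ := by
  have geometric : ∀ n, gridStep n ^ θ = ((1 / 2 : ℝ) ^ θ) ^ (n + 2) := fun n => by
    rw [gridStep, ← Real.rpow_natCast_mul (by norm_num), mul_comm,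
      Real.rpow_mul_natCast (by norm_num)]
  simp_rw [geometric]
  exact (summable_nat_add_iff 2).2 (summable_geometric_of_lt_one (by positivity)
    (Real.rpow_lt_one (by norm_num) (by norm_num) hθ))

end Grid

/-- The distance by which the path has to move in the `n`-th block. -/
def level (ρ : ℝ) (n : ℕ) : ℝ := gridStep n ^ ρ

/-- The path moves far enough in the `n`-th block. -/
abbrev GridHit (ρ : ℝ) (x : I → ℝ) (n : ℕ) : Prop :=
  Hit x (level ρ n) (gridTime n) (gridTime (n + 1))

/-- The elementary integrand on `[gridTime n, gridTime (n + 1)]`. -/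
def gridBlock (ρ : ℝ) (x : I → ℝ) (n : ℕ) : I → ℝ :=
  block x (level ρ n) (gridTime n) (gridTime (n + 1))

/-- The integral of the integrand formed by the first `n` blocks over `[0, t]`, for
`t ≥ gridTime n`, as a function of `y = x t`. Each block is multiplied by the distance from the
integral accumulated so far to the current value of the target `z`. -/
def wealth (ρ : ℝ) (x z : I → ℝ) : ℕ → ℝ → ℝ
  | 0, _ => 0
  | n + 1, y => wealth ρ x z n y + (z (gridTime n) - wealth ρ x z n (x (gridTime n))) *
      (blockValue x (level ρ n) (gridTime n) (gridTime (n + 1))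
        + gridBlock ρ x n (gridTime (n + 1)) * (y - x (gridTime (n + 1))))

/-- The amount by which the first `n` blocks miss the target at time `gridTime n`. -/
def gap (ρ : ℝ) (x z : I → ℝ) (n : ℕ) : ℝ := z (gridTime n) - wealth ρ x z n (x (gridTime n))

/-- The integrand of the representation, for given paths `x` of the integrator and `z` of the
target. -/
def integrand (ρ : ℝ) (x z : I → ℝ) (t : I) : ℝ := ∑' n, gap ρ x z n * gridBlock ρ x n t

/-- The `n`-th term of `integrand`, as a function on the real line. It agrees with
`gap ρ x z n * gridBlock ρ x n` on `[0, 1]` when `x` is continuous. -/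
def summand (ρ : ℝ) (x z : I → ℝ) (n : ℕ) : ℝ → ℝ :=
  frozen (fun y => gap ρ x z n * bump (level ρ n) y) (extend x) (gridTime n)
    (hitTime x (level ρ n) (gridTime n) (gridTime (n + 1)))

section Wealth

variable {ρ κ : ℝ} {x z : I → ℝ} {n : ℕ}

lemma level_pos (ρ : ℝ) (n : ℕ) : 0 < level ρ n := Real.rpow_pos_of_pos (gridStep_pos n) ρ

lemma wealth_succ (ρ : ℝ) (x z : I → ℝ) (n : ℕ) (y : ℝ) :
    wealth ρ x z (n + 1) y = wealth ρ x z n y + gap ρ x z n *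
      (blockValue x (level ρ n) (gridTime n) (gridTime (n + 1))
        + gridBlock ρ x n (gridTime (n + 1)) * (y - x (gridTime (n + 1)))) := rfl

lemma wealth_succ_of_hit (h : GridHit ρ x n) (y : ℝ) :
    wealth ρ x z (n + 1) y = wealth ρ x z n y + gap ρ x z n := by
  rw [wealth_succ, blockValue, if_pos h, gridBlock, block, min_self, if_neg fun h' => h'.2 h,
    zero_mul, add_zero, mul_one]

lemma gap_succ_of_hit (h : GridHit ρ x n) : gap ρ x z (n + 1)
    = (z (gridTime (n + 1)) - z (gridTime n))
      - (wealth ρ x z n (x (gridTime (n + 1))) - wealth ρ x z n (x (gridTime n))) := by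
  rw [gap, wealth_succ_of_hit h, gap]
  ring

lemma exists_wealth_sub_eq (ρ : ℝ) (x z : I → ℝ) (n : ℕ) :
    ∃ S, ∀ y y', wealth ρ x z n y - wealth ρ x z n y' = S * (y - y') := by
  induction n with
  | zero => exact ⟨0, fun y y' => by simp [wealth]⟩
  | succ n ih =>
    obtain ⟨S, hS⟩ := ih
    refine ⟨S + gap ρ x z n * gridBlock ρ x n (gridTime (n + 1)), fun y y' => ?_⟩
    rw [wealth_succ, wealth_succ]
    linear_combination hS y y'

lemma exists_eventually_wealth_sub_eq (z : I → ℝ) (h : ∀ᶠ n in atTop, GridHit ρ x n) :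
    ∃ S, ∀ᶠ n in atTop, ∀ y y', wealth ρ x z n y - wealth ρ x z n y' = S * (y - y') := by
  obtain ⟨N, hN⟩ := eventually_atTop.1 h
  obtain ⟨S, hS⟩ := exists_wealth_sub_eq ρ x z N
  refine ⟨S, eventually_atTop.2 ⟨N, fun n hn => ?_⟩⟩
  induction n, hn using Nat.le_induction with
  | base => exact hS
  | succ n hn ih =>
    intro y y'
    rw [wealth_succ_of_hit (hN n hn), wealth_succ_of_hit (hN n hn), add_sub_add_right_eq_sub, ih]

lemma tendsto_wealth (hx : Continuous x) (hz : Continuous z)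
    (h : ∀ᶠ n in atTop, GridHit ρ x n) :
    Tendsto (fun n => wealth ρ x z n (x 1)) atTop (𝓝 (z 1)) := by
  obtain ⟨S, hS⟩ := exists_eventually_wealth_sub_eq z h
  have limit := ((hz.tendsto 1).comp tendsto_gridTime).add
    ((((hx.tendsto 1).comp tendsto_gridTime).const_sub (x 1)).const_mul S)
  rw [sub_self, mul_zero, add_zero] at limit
  rw [← tendsto_add_atTop_iff_nat 1]
  refine limit.congr' ?_
  filter_upwards [h, hS] with n hn hSn
  rw [wealth_succ_of_hit hn, gap]
  simp only [Function.comp_apply]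
  linear_combination -hSn (x 1) (x (gridTime n))

lemma abs_gridTime_increment_le {K q : ℝ≥0} {y : I → ℝ} (hy : HolderWith K q y) (hκ : κ ≤ q)
    (n : ℕ) : |y (gridTime (n + 1)) - y (gridTime n)| ≤ K * gridStep n ^ κ := by
  have h := hy.dist_le (gridTime (n + 1)) (gridTime n)
  rw [Subtype.dist_eq, Real.dist_eq, Real.dist_eq, gridTime_succ_sub,
    abs_of_pos (gridStep_pos n)] at h
  exact h.trans (mul_le_mul_of_nonneg_left
    (Real.rpow_le_rpow_of_exponent_ge (gridStep_pos n) (gridStep_le_one n) hκ) K.coe_nonneg)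

lemma exists_eventually_abs_gap_le {C r C' a : ℝ≥0} (hx : HolderWith C r x)
    (hz : HolderWith C' a z) (hκr : κ ≤ r) (hκa : κ ≤ a) (h : ∀ᶠ n in atTop, GridHit ρ x n) :
    ∃ B, ∀ᶠ n in atTop, |gap ρ x z n| ≤ B * gridStep n ^ κ := by
  obtain ⟨S, hS⟩ := exists_eventually_wealth_sub_eq z h
  refine ⟨(C' + |S| * C) * 2 ^ κ, ?_⟩
  rw [← map_add_atTop_eq_nat 1, eventually_map]
  filter_upwards [h, hS] with n hn hSn
  rw [gap_succ_of_hit hn, hSn, mul_assoc, ← Real.mul_rpow two_pos.le (gridStep_pos _).le,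
    ← gridStep_eq_two_mul, add_mul, mul_assoc]
  refine (abs_sub _ _).trans ?_
  rw [abs_mul]
  gcongr
  · exact abs_gridTime_increment_le hz hκa n
  · exact abs_gridTime_increment_le hx hκr n

end Wealth

lemma tsum_ne_top_of_eventually_le {u : ℕ → ℝ≥0∞} {v : ℕ → ℝ} (hu : ∀ n, u n ≠ ∞)
    (hv : Summable v) (h : ∀ᶠ n in atTop, u n ≤ ENNReal.ofReal (v n)) : ∑' n, u n ≠ ∞ := by
  obtain ⟨N, hN⟩ := eventually_atTop.1 h
  rw [← ENNReal.summable.sum_add_tsum_nat_add' (k := N)]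
  refine ENNReal.add_ne_top.2 ⟨ENNReal.sum_ne_top.2 fun n _ => hu n, ?_⟩
  exact ne_top_of_le_ne_top ((summable_nat_add_iff N).2 hv).tsum_ofReal_ne_top
    (ENNReal.tsum_le_tsum fun n => hN (n + N) (Nat.le_add_left N n))

section Integrand

variable {ρ : ℝ} {x z : I → ℝ} {n : ℕ} {s : ℝ}

lemma gridBlock_of_le {t : I} (ht : t ≤ gridTime n) : gridBlock ρ x n t = 0 :=
  block_of_le (gridTime_le_succ n) ht

lemma gridBlock_of_lt {N : ℕ} {t : I} (ht : t < gridTime N) (hn : n ∉ Finset.range N) :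
    gridBlock ρ x n t = 0 :=
  gridBlock_of_le <| ht.le.trans <| strictMono_gridTime.monotone <| by simpa using hn

lemma exists_lt_gridTime {t : I} (ht : t < 1) : ∃ N, t < gridTime N :=
  (tendsto_gridTime.eventually (lt_mem_nhds ht)).exists

lemma hasSum_integrand {t : I} (ht : t < 1) :
    HasSum (fun n => gap ρ x z n * gridBlock ρ x n t) (integrand ρ x z t) := by
  obtain ⟨N, hN⟩ := exists_lt_gridTime ht
  exact (summable_of_ne_finset_zero (s := Finset.range N) fun n hn => by
    rw [gridBlock_of_lt hN hn, mul_zero]).hasSum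

lemma continuous_gridBlock (hx : Continuous x) (n : ℕ) : Continuous (gridBlock ρ x n) := by
  rw [gridBlock, funext (block_eq_frozen hx (level_pos ρ n) (gridTime_le_succ n))]
  have := (contDiff_bump (level ρ n)).continuous
  unfold frozen
  fun_prop

lemma continuousOn_integrand (hx : Continuous x) : ContinuousOn (integrand ρ x z) (Iio 1) := by
  intro t ht
  obtain ⟨N, hN⟩ := exists_lt_gridTime ht
  have finite : integrand ρ x z
      =ᶠ[𝓝 t] fun t => ∑ n ∈ Finset.range N, gap ρ x z n * gridBlock ρ x n t := by
    filter_upwards [Iio_mem_nhds hN] with s hs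
    exact tsum_eq_sum fun n hn => by rw [gridBlock_of_lt hs hn, mul_zero]
  have continuous := fun n => continuous_gridBlock (ρ := ρ) hx n
  exact (ContinuousAt.congr (by fun_prop) finite.symm).continuousWithinAt

lemma summand_eq (hx : Continuous x) (n : ℕ) (t : I) :
    summand ρ x z n t = gap ρ x z n * gridBlock ρ x n t := by
  rw [gridBlock, block_eq_frozen hx (level_pos ρ n) (gridTime_le_succ n)]
  rfl

lemma hasSum_summand (hx : Continuous x) (hs : s ∈ Ico 0 1) :
    HasSum (fun n => summand ρ x z n s) (extend (integrand ρ x z) s) := by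
  lift s to I using ⟨hs.1, hs.2.le⟩
  simp only [summand_eq hx, extend_coe]
  exact hasSum_integrand hs.2

lemma measurable_extend_integrand (hx : Continuous x) :
    Measurable (extend (integrand ρ x z)) := by
  have measurable := fun n => (continuous_gridBlock (ρ := ρ) hx n).measurable
  have : Measurable (integrand ρ x z) := Measurable.tsum fun n => (measurable n).const_mul _
  exact this.comp continuous_projIcc.measurable

lemma summand_of_le (hs : s ≤ gridTime n) : summand ρ x z n s = 0 :=
  frozen_of_le (by rw [bump_zero, mul_zero]) hs

lemma summand_of_notMem (hx : Continuous x) (h : GridHit ρ x n)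
    (hs : s ∉ Ioo (gridTime n : ℝ) (gridTime (n + 1))) : summand ρ x z n s = 0 := by
  rcases le_or_gt s (gridTime n) with hs' | hs'
  · exact summand_of_le hs'
  have hτs : (hitTime x (level ρ n) (gridTime n) (gridTime (n + 1)) : ℝ) ≤ s :=
    (Subtype.coe_le_coe.2 hitTime_le).trans (not_lt.1 fun h' => hs ⟨hs', h'⟩)
  rw [summand, frozen_of_ge (le_hitTime (gridTime_le_succ n)) hτs, extend_coe, extend_coe,
    bump_of_le (level_pos ρ n) (le_abs_hitTime_of_hit hx h), mul_zero]

variable {C r L : ℝ≥0} {β : ℝ}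

lemma holderWith_extend (hx : HolderWith C r x) : HolderWith C r (extend x) := by
  simpa using! hx.comp (holderWith_one.2 (LipschitzWith.projIcc zero_le_one))

lemma lipschitzWith_gap_mul_bump (hL : ∀ ε, LipschitzWith (L / ‖ε‖₊ ^ 2) (bump ε)) (n : ℕ) :
    LipschitzWith (‖gap ρ x z n‖₊ * (L / ‖level ρ n‖₊ ^ 2))
      fun y => gap ρ x z n * bump (level ρ n) y :=
  (lipschitzWith_smul (gap ρ x z n)).comp (hL (level ρ n))

lemma holderWith_summand (hx : HolderWith C r x)
    (hL : ∀ ε, LipschitzWith (L / ‖ε‖₊ ^ 2) (bump ε)) (n : ℕ) :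
    HolderWith (‖gap ρ x z n‖₊ * (L / ‖level ρ n‖₊ ^ 2) * C) r (summand ρ x z n) :=
  holderWith_frozen (holderWith_extend hx) (lipschitzWith_gap_mul_bump hL n) _ _

lemma glsIntegral_summand (hx : HolderWith C r x) (hβ0 : 0 < β) (hβ1 : β < 1) (hβr : β < r)
    (hβr' : 1 - β < r) (n : ℕ) :
    glsIntegral β (summand ρ x z n) (extend x)
      = wealth ρ x z (n + 1) (x 1) - wealth ρ x z n (x 1) := by
  obtain ⟨L, hL⟩ := exists_lipschitzWith_bump
  have hr : 0 < r := NNReal.coe_pos.1 (hβ0.trans hβr)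
  have x_one : extend x 1 = x 1 := extend_coe x 1
  rw [summand, glsIntegral_frozen (K := fun y => gap ρ x z n * profile (level ρ n) y) hβ0 hβ1 hβr
      hβr' (holderWith_extend hx) (gridTime n).2.1 (le_hitTime (gridTime_le_succ n))
      (hitTime x _ _ _).2.2 (fun y => (hasDerivAt_profile _ y).const_mul _)
      (lipschitzWith_gap_mul_bump hL n) (by rw [bump_zero, mul_zero])
      (by rw [profile_zero, mul_zero]),
    wealth_succ, gridBlock,
    blockValue_add_block_mul (hx.continuous hr) (level_pos ρ n) (gridTime_le_succ n),
    x_one, extend_coe, extend_coe]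
  ring

lemma fracNorm_summand_lt_top (hx : HolderWith C r x) (hβ0 : 0 < β) (hβr : β < r) (n : ℕ) :
    fracNorm β 0 1 (summand ρ x z n) < ∞ := by
  obtain ⟨L, hL⟩ := exists_lipschitzWith_bump
  exact fracNorm_lt_top_of_holderWith (holderWith_summand hx hL n)
    (summand_of_le (gridTime n).2.1) hβ0 hβr

lemma exists_fracNorm_summand_le (z : I → ℝ) (hx : HolderWith C r x) (hβ0 : 0 < β) (hβ1 : β < 1)
    (hβr : β < r) : ∃ A, 0 ≤ A ∧ ∀ n, GridHit ρ x n → fracNorm β 0 1 (summand ρ x z n)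
      ≤ ENNReal.ofReal (A * |gap ρ x z n| * gridStep n ^ (1 + r - β - 2 * ρ)) := by
  obtain ⟨L, hL⟩ := exists_lipschitzWith_bump
  have hr : 0 < r := NNReal.coe_pos.1 (hβ0.trans hβr)
  have : 0 < r - β := sub_pos.2 hβr
  refine ⟨(2 + 2 * (1 / (r - β) + 1 / β)) * L * C, by positivity, fun n hn => ?_⟩
  have bound := fracNorm_le_of_support (holderWith_summand (z := z) hx hL n) hβ0 hβ1 hβr
    (half_le_gridTime n) (Subtype.coe_lt_coe.2 (strictMono_gridTime n.lt_succ_self))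
    (gridTime (n + 1)).2.2 fun s => summand_of_notMem (hx.continuous hr) hn
  have level_sq : level ρ n ^ 2 = gridStep n ^ (2 * ρ) := by
    rw [level, ← Real.rpow_mul_natCast (gridStep_pos n).le, Nat.cast_two, mul_comm]
  refine bound.trans_eq (congrArg ENNReal.ofReal ?_)
  rw [gridTime_succ_sub, Real.rpow_sub (gridStep_pos n) (1 + r - β)]
  push_cast
  rw [Real.norm_eq_abs, Real.norm_of_nonneg (level_pos ρ n).le, level_sq]
  ring

variable {C' a : ℝ≥0} {κ : ℝ}

lemma tsum_fracNorm_summand_ne_top (hx : HolderWith C r x) (hz : HolderWith C' a z) (hβ0 : 0 < β)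
    (hβ1 : β < 1) (hβr : β < r) (hκa : κ ≤ a) (hκr : κ ≤ r) (hθ : 0 < κ + 1 + r - β - 2 * ρ)
    (h : ∀ᶠ n in atTop, GridHit ρ x n) : ∑' n, fracNorm β 0 1 (summand ρ x z n) ≠ ∞ := by
  obtain ⟨A, hA, bound⟩ := exists_fracNorm_summand_le (ρ := ρ) z hx hβ0 hβ1 hβr
  obtain ⟨B, gap_le⟩ := exists_eventually_abs_gap_le hx hz hκr hκa h
  refine tsum_ne_top_of_eventually_le (fun n => (fracNorm_summand_lt_top hx hβ0 hβr n).ne)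
    ((summable_gridStep_rpow hθ).mul_left (A * B)) ?_
  filter_upwards [h, gap_le] with n hn hgap
  refine (bound n hn).trans (ENNReal.ofReal_le_ofReal ?_)
  have hΔ := gridStep_pos n
  calc A * |gap ρ x z n| * gridStep n ^ (1 + r - β - 2 * ρ)
      ≤ A * (B * gridStep n ^ κ) * gridStep n ^ (1 + r - β - 2 * ρ) := by gcongr
    _ = A * B * gridStep n ^ (κ + 1 + r - β - 2 * ρ) := by
        rw [show κ + 1 + r - β - 2 * ρ = κ + (1 + r - β - 2 * ρ) by ring, Real.rpow_add hΔ]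
        ring

lemma hasIntegral_integrand (hx : HolderWith C r x) (hz : HolderWith C' a z) (hβ0 : 0 < β)
    (hβ1 : β < 1) (hβr : β < r) (hβr' : 1 - β < r) (ha : 0 < a) (hκa : κ ≤ a) (hκr : κ ≤ r)
    (hθ : 0 < κ + 1 + r - β - 2 * ρ) (h : ∀ᶠ n in atTop, GridHit ρ x n) :
    HasIntegral β 0 1 (extend (integrand ρ x z)) (extend x) (z 1) := by
  obtain ⟨L, hL⟩ := exists_lipschitzWith_bump
  have hr : 0 < r := NNReal.coe_pos.1 (hβ0.trans hβr)
  have hxc := hx.continuous hr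
  have measurable : ∀ n, Measurable (summand ρ x z n) := fun n =>
    ((holderWith_summand hx hL n).continuous hr).measurable
  have hasSum : ∀ s ∈ Ico (0 : ℝ) 1,
      HasSum (fun n => summand ρ x z n s) (extend (integrand ρ x z) s) := fun _ hs =>
    hasSum_summand hxc hs
  have norm := tsum_fracNorm_summand_ne_top hx hz hβ0 hβ1 hβr hκa hκr hθ h
  have partialSums := (hasSum_glsIntegral hβ0 hβ1 hβr' measurable (holderWith_extend hx) hasSum
    norm).tendsto_sum_nat
  simp only [glsIntegral_summand hx hβ0 hβ1 hβr hβr', Finset.sum_range_sub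
    fun n => wealth ρ x z n (x 1)] at partialSums
  have value : glsIntegral β (extend (integrand ρ x z)) (extend x) = z 1 :=
    tendsto_nhds_unique partialSums <| by
      simpa only [wealth, sub_zero] using tendsto_wealth hxc (hz.continuous ha) h
  rw [← value]
  exact hasIntegral_glsIntegral hβ0 hβ1 hβr' (measurable_extend_integrand hxc)
    ((fracNorm_le_tsum measurable hasSum).trans_lt norm.lt_top) (holderWith_extend hx)

end Integrand

lemma eq_of_holderWith_of_one_lt {C r : ℝ≥0} {f : ℝ → ℝ} (hf : HolderWith C r f) (hr : 1 < r)
    (s t : ℝ) : f s = f t := by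
  have hr0 : 0 < r := one_pos.trans hr
  have dimH_lt : dimH (range f) < Module.finrank ℝ ℝ := by
    refine (hf.dimH_range_le hr0).trans_lt ?_
    rw [Real.dimH_univ, Module.finrank_self, Nat.cast_one, one_div]
    exact ENNReal.inv_lt_one.2 (ENNReal.one_lt_coe_iff.2 hr)
  by_contra hst
  obtain ⟨y, hy, hyf⟩ := (dense_compl_of_dimH_lt_finrank dimH_lt).exists_between
    (min_lt_max.2 hst)
  refine hy (mem_range_of_exists_le_of_exists_ge (hf.continuous hr0) ?_ ?_)
  · exact (min_lt_iff.1 hyf.1).elim (fun h => ⟨s, h.le⟩) fun h => ⟨t, h.le⟩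
  · exact (lt_max_iff.1 hyf.2).elim (fun h => ⟨s, h.le⟩) fun h => ⟨t, h.le⟩

section Adapted

variable {Ω : Type*} [mΩ : MeasurableSpace Ω] {𝓕 : Filtration I mΩ} {X z : I → Ω → ℝ}

lemma measurableSet_hit (hX : StronglyAdapted 𝓕 X) (ε : ℝ) (c t : I) :
    MeasurableSet[𝓕 t] {ω | Hit (fun s => X s ω) ε c t} := by
  simp only [Hit, ofPred_exists, ofPred_and]
  refine MeasurableSet.iUnion fun k => ?_
  by_cases hk : denseSeq I k ∈ Icc c t
  · have measurable_X : Measurable[𝓕 t] (X (denseSeq I k)) :=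
      (hX.stronglyMeasurable_le hk.2).measurable
    have measurable_Xc : Measurable[𝓕 t] (X c) :=
      (hX.stronglyMeasurable_le (hk.1.trans hk.2)).measurable
    exact (MeasurableSet.const _).inter
      (continuous_abs.measurable.comp (measurable_X.sub measurable_Xc) measurableSet_Ici)
  · simp [hk]

lemma measurable_block (hX : StronglyAdapted 𝓕 X) (ε : ℝ) (c d t : I) :
    Measurable[𝓕 t] fun ω => block (fun s => X s ω) ε c d t := by
  by_cases hct : c ≤ t
  · have measurable_X : Measurable[𝓕 t] (X (min t d)) :=
      (hX.stronglyMeasurable_le (min_le_left t d)).measurable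
    have measurable_Xc : Measurable[𝓕 t] (X c) := (hX.stronglyMeasurable_le hct).measurable
    have hit : MeasurableSet[𝓕 t] {ω | Hit (fun s => X s ω) ε c (min t d)} :=
      𝓕.mono (min_le_left t d) _ (measurableSet_hit hX ε c (min t d))
    exact Measurable.ite ((MeasurableSet.const _).inter hit.compl)
      ((contDiff_bump ε).continuous.measurable.comp (measurable_X.sub measurable_Xc))
      measurable_const
  · simp only [block, hct, false_and, if_false]
    exact measurable_const

lemma measurable_blockValue (hX : StronglyAdapted 𝓕 X) (ε : ℝ) {c d : I} (hcd : c ≤ d) :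
    Measurable[𝓕 d] fun ω => blockValue (fun s => X s ω) ε c d :=
  Measurable.ite (measurableSet_hit hX ε c d) measurable_const <|
    (contDiff_profile ε (n := 0)).continuous.measurable.comp <|
      (hX d).measurable.sub (hX.stronglyMeasurable_le hcd).measurable

lemma measurable_wealth (hX : StronglyAdapted 𝓕 X) (hz : StronglyAdapted 𝓕 z) (ρ : ℝ) (n : ℕ)
    {t : I} (ht : gridTime n ≤ t) {Y : Ω → ℝ} (hY : Measurable[𝓕 t] Y) :
    Measurable[𝓕 t] fun ω => wealth ρ (fun s => X s ω) (fun s => z s ω) n (Y ω) := by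
  induction n generalizing t Y with
  | zero => exact measurable_const
  | succ n ih =>
    have hn := (gridTime_le_succ n).trans ht
    have measurable_X {s : I} (hs : s ≤ t) : Measurable[𝓕 t] (X s) :=
      (hX.stronglyMeasurable_le hs).measurable
    have measurable_gap := (hz.stronglyMeasurable_le hn).measurable.sub (ih hn (measurable_X hn))
    have measurable_gridBlock := (measurable_block hX (level ρ n) (gridTime n) (gridTime (n + 1))
      (gridTime (n + 1))).mono (𝓕.mono ht) le_rfl
    have measurable_value :=
      (measurable_blockValue hX (level ρ n) (gridTime_le_succ n)).mono (𝓕.mono ht) le_rfl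
    exact (ih hn hY).add <| measurable_gap.mul <|
      measurable_value.add <| measurable_gridBlock.mul <| hY.sub (measurable_X ht)

lemma measurable_gap (hX : StronglyAdapted 𝓕 X) (hz : StronglyAdapted 𝓕 z) (ρ : ℝ) (n : ℕ) :
    Measurable[𝓕 (gridTime n)] fun ω => gap ρ (fun s => X s ω) (fun s => z s ω) n :=
  (hz _).measurable.sub (measurable_wealth hX hz ρ n le_rfl (hX _).measurable)

lemma stronglyAdapted_integrand (hX : StronglyAdapted 𝓕 X) (hz : StronglyAdapted 𝓕 z) (ρ : ℝ) :
    StronglyAdapted 𝓕 fun t ω => integrand ρ (fun s => X s ω) (fun s => z s ω) t := by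
  intro t
  have measurable_term (n : ℕ) : Measurable[𝓕 t] fun ω =>
      gap ρ (fun s => X s ω) (fun s => z s ω) n * gridBlock ρ (fun s => X s ω) n t := by
    by_cases ht : gridTime n ≤ t
    · exact ((measurable_gap hX hz ρ n).mono (𝓕.mono ht) le_rfl).mul (measurable_block hX _ _ _ t)
    · simp_rw [gridBlock_of_le (le_of_not_ge ht), mul_zero]
      exact measurable_const
  let _ := 𝓕 t
  exact (Measurable.tsum measurable_term).stronglyMeasurable

end Adapted

section SmallBall

variable {Ω : Type*} [MeasurableSpace Ω] {P : Measure Ω} {X : I → Ω → ℝ} {α : ℝ}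

lemma HolderPaths.ae_holderWith {r : ℝ≥0} (h : HolderPaths P X r) :
    ∀ᵐ ω ∂P, ∃ C, HolderWith C r fun t => X t ω := by
  filter_upwards [h] with ω ⟨C, hC⟩
  have hC0 : 0 ≤ C := by simpa using (abs_nonneg _).trans (hC 0 1)
  lift C to ℝ≥0 using hC0
  refine ⟨C, holderWith_of_dist_le fun s t => ?_⟩
  simpa only [Real.dist_eq, Subtype.dist_eq] using hC t s

lemma HolderPaths.ae_eq_of_one_lt {r : ℝ} (h : HolderPaths P X r) (hr : 1 < r) :
    ∀ᵐ ω ∂P, ∀ s t, X s ω = X t ω := by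
  lift r to ℝ≥0 using by linarith
  filter_upwards [h.ae_holderWith] with ω ⟨C, hC⟩ s t
  simpa only [extend_coe] using
    eq_of_holderWith_of_one_lt (holderWith_extend hC) (NNReal.one_lt_coe.1 hr) s t

lemma eventually_lt_gridTime {δ : ℝ} (hδ : 0 < δ) : ∀ᶠ n in atTop, 1 - δ < (gridTime n : ℝ) :=
  (continuous_subtype_val.tendsto' (1 : I) 1 rfl).comp tendsto_gridTime
    |>.eventually_const_lt (by linarith)

lemma SmallBall.not_ae_const [IsProbabilityMeasure P] (h : SmallBall P X α) :
    ¬∀ᵐ ω ∂P, ∀ s t, X s ω = X t ω := by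
  intro hconst
  obtain ⟨δ, hδ, C, hC, h⟩ := h
  obtain ⟨n, hn⟩ := (eventually_lt_gridTime hδ).exists
  have hΔ : 0 < ((1 : I) : ℝ) - gridTime n :=
    sub_pos.2 <| Subtype.coe_lt_coe.2 <| (strictMono_gridTime n.lt_succ_self).trans_le le_one'
  set ε := (((1 : I) : ℝ) - gridTime n) ^ α
  have hε : 0 < ε := Real.rpow_pos_of_pos hΔ α
  have exp_lt_one : Real.exp (-C * (((1 : I) : ℝ) - gridTime n) * ε ^ (-1 / α)) < 1 := by
    have := Real.rpow_pos_of_pos hε (-1 / α)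
    rw [Real.exp_lt_one_iff, neg_mul, neg_mul, neg_lt_zero]
    positivity
  have prob_eq_one : P.real {ω | ∀ u ∈ Icc (gridTime n) 1, |X u ω - X (gridTime n) ω| ≤ ε} = 1 := by
    rw [← probReal_univ (μ := P)]
    refine measureReal_congr (eventuallyEq_univ.2 ?_)
    filter_upwards [hconst] with ω hω u _
    simpa only [hω u (gridTime n), sub_self, abs_zero] using hε.le
  exact exp_lt_one.not_ge (prob_eq_one ▸ h _ 1 hn.le le_one' ε hε le_rfl)

lemma SmallBall.le_one [IsProbabilityMeasure P] (h : SmallBall P X α)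
    (hX : ∀ r : ℝ, 0 < r → r < α → HolderPaths P X r) : α ≤ 1 := by
  by_contra! hα
  obtain ⟨r, hr, hrα⟩ := exists_between hα
  exact h.not_ae_const ((hX r (by linarith) hrα).ae_eq_of_one_lt hr)

lemma SmallBall.exists_eventually_measure_le [IsFiniteMeasure P] (h : SmallBall P X α)
    {ρ : ℝ} (hρ : α ≤ ρ) :
    ∃ K, ∀ᶠ n in atTop, P {ω | ∀ u ∈ Icc (gridTime n) (gridTime (n + 1)),
      |X u ω - X (gridTime n) ω| ≤ level ρ n} ≤ ENNReal.ofReal (K * gridStep n ^ (ρ / α - 1)) := by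
  obtain ⟨δ, hδ, C, hC, h⟩ := h
  refine ⟨C⁻¹, (eventually_lt_gridTime hδ).mono fun n hn => ?_⟩
  have hΔ := gridStep_pos n
  have level_le : level ρ n ≤ ((gridTime (n + 1) : ℝ) - gridTime n) ^ α := by
    rw [gridTime_succ_sub]
    exact Real.rpow_le_rpow_of_exponent_ge hΔ (gridStep_le_one n) hρ
  set y := C * gridStep n ^ (-(ρ / α - 1)) with hy
  have hy0 : 0 < y := mul_pos hC (Real.rpow_pos_of_pos hΔ _)
  have exponent : -C * ((gridTime (n + 1) : ℝ) - gridTime n) * level ρ n ^ (-1 / α) = -y := by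
    rw [gridTime_succ_sub, level, ← Real.rpow_mul hΔ.le, hy,
      show -(ρ / α - 1) = 1 + ρ * (-1 / α) by ring, Real.rpow_add hΔ, Real.rpow_one]
    ring
  rw [← ofReal_measureReal]
  refine ENNReal.ofReal_le_ofReal ?_
  calc P.real _ ≤ Real.exp (-y) :=
        exponent ▸ h _ _ hn.le (gridTime_le_succ n) _ (level_pos ρ n) level_le
    _ ≤ y⁻¹ := by
        rw [Real.exp_neg]
        exact inv_anti₀ hy0 (by linarith [Real.add_one_le_exp y])
    _ = C⁻¹ * gridStep n ^ (ρ / α - 1) := by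
        rw [hy, mul_inv, Real.rpow_neg hΔ.le, inv_inv]

lemma SmallBall.ae_eventually_gridHit [IsFiniteMeasure P] (h : SmallBall P X α) (hα : 0 < α)
    {ρ : ℝ} (hρ : α < ρ) (hX : ∀ᵐ ω ∂P, Continuous fun t => X t ω) :
    ∀ᵐ ω ∂P, ∀ᶠ n in atTop, GridHit ρ (fun t => X t ω) n := by
  obtain ⟨K, hK⟩ := h.exists_eventually_measure_le hρ.le
  have summable : Summable fun n => K * gridStep n ^ (ρ / α - 1) :=
    (summable_gridStep_rpow (sub_pos.2 ((one_lt_div hα).2 hρ))).mul_left K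
  have borelCantelli :=
    ae_eventually_notMem (tsum_ne_top_of_eventually_le (fun _ => measure_ne_top P _) summable hK)
  filter_upwards [borelCantelli, hX] with ω hω hcont
  refine hω.mono fun n hn => hit_of_exists_lt hcont (strictMono_gridTime n.lt_succ_self) ?_
  by_contra! hsmall
  exact hn hsmall

end SmallBall

end GLS

end

theorem mainTheorem1 {Ω : Type*} [mΩ : MeasurableSpace Ω] (P : Measure Ω) [IsProbabilityMeasure P]
    (𝓕 : Filtration I mΩ) (X : I → Ω → ℝ) (hX : StronglyAdapted 𝓕 X)
    (α : ℝ) (hα : 1 / 2 < α)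
    (hX_holder : ∀ r : ℝ, 0 < r → r < α → GLS.HolderPaths P X r)
    (hX_small : GLS.SmallBall P X α)
    (ξ : Ω → ℝ) (z : I → Ω → ℝ) (hz : StronglyAdapted 𝓕 z)
    (a : ℝ) (ha : 0 < a) (hz_holder : GLS.HolderPaths P z a)
    (hξ : ∀ᵐ ω ∂P, z 1 ω = ξ ω) :
    ∃ ψ : I → Ω → ℝ, StronglyAdapted 𝓕 ψ ∧
      (∀ᵐ ω ∂P, ContinuousOn (fun t : I => ψ t ω) (Iio 1)) ∧
      ∃ β : ℝ, 1 - α < β ∧ 0 < β ∧ β < 1 ∧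
        ∀ᵐ ω ∂P, GLS.HasIntegral β 0 1
          (IccExtend zero_le_one fun t : I => ψ t ω)
          (IccExtend zero_le_one fun t : I => X t ω) (ξ ω) := by
  have hα1 : α ≤ 1 := hX_small.le_one hX_holder
  obtain ⟨κ, hκ, hκaα⟩ : ∃ κ : ℝ, 0 < κ ∧ 40 * κ ≤ min a (2 * α - 1) := by
    have : 0 < min a (2 * α - 1) := lt_min ha (by linarith)
    exact ⟨min a (2 * α - 1) / 40, by positivity, by linarith⟩
  obtain ⟨hκa, hκα⟩ := le_min_iff.1 hκaα
  lift a to NNReal using ha.le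
  obtain ⟨r, hr⟩ : ∃ r : NNReal, (r : ℝ) = α - κ := ⟨⟨α - κ, by linarith⟩, rfl⟩
  have hX_holderWith := (hX_holder r (by linarith) (by linarith)).ae_holderWith
  have hX_cont : ∀ᵐ ω ∂P, Continuous fun t => X t ω :=
    hX_holderWith.mono fun ω ⟨_, h⟩ => h.continuous (NNReal.coe_pos.1 (by linarith))
  have hX_hit := hX_small.ae_eventually_gridHit (ρ := α + κ) (by linarith) (by linarith) hX_cont
  refine ⟨fun t ω => GLS.integrand (α + κ) (fun s => X s ω) (fun s => z s ω) t,
    GLS.stronglyAdapted_integrand hX hz _, hX_cont.mono fun ω => GLS.continuousOn_integrand,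
    1 - α + 2 * κ, by linarith, by linarith, by linarith, ?_⟩
  filter_upwards [hX_holderWith, hz_holder.ae_holderWith, hξ, hX_hit]
    with ω ⟨C, hC⟩ ⟨C', hC'⟩ hω hhit
  rw [← hω]
  exact GLS.hasIntegral_integrand (κ := 10 * κ) hC hC' (by linarith) (by linarith) (by linarith)
    (by linarith) (by linarith) (by linarith) (by linarith) (by linarith) hhit
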